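/- A (connected) map $\mathcal M$, possibly non-orientable or with boundary, is given by a non-empty set $\Phi$ of flags and permutations $r_0,r_1,r_2$ of $\Phi$ with $r_0^2=r_1^2=r_2^2=(r_0r_2)^2=1$, generating a transitive group on $\Phi$. Its edges are the orbits of $\langle r_0,r_2\rangle$; an isomorphism of maps is a bijection of flags commuting with $r_0,r_1,r_2$. The group ${\rm Aut}\,\mathcal M$ is the centraliser of $\langle r_0,r_1,r_2\rangle$ in ${\rm Sym}\,\Phi$; $\mathcal M$ is edge-transitive if ${\rm Aut}\,\mathcal M$ is transitive on edges. The quotient map $\mathcal M/{\rm Aut}\,\mathcal M$ has as flags the orbits of ${\rm Aut}\,\mathcal M$ on $\Phi$, with the induced permutations. The dual $D(\mathcal M)$ is obtained by replacing $(r_0,r_1,r_2)$ with $(r_2,r_1,r_0)$, and the Petrie dual $P(\mathcal M)$ by replacing it with $(r_0r_2,r_1,r_2)$. The 14 Graver–Watkins classes $T$ are $1$, $3$, and $2^\sigma$, $2^\sigma{\rm ex}$, $4^\sigma$, $5^\sigma$ with $\sigma\in\{\emptyset,*,P\}$; an edge-transitive map $\mathcal M$ is in $T$ when $\mathcal M/{\rm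 Aut}\,\mathcal M\cong\mathcal N(T)$, where the one-edge maps $\mathcal N(T)$ are as follows. - $\mathcal N(1)$ has one flag. - $\mathcal N(2)$ and $\mathcal N(2\,{\rm ex})$ have two flags. In both, $r_0$ transposes them and $r_2=1$; $r_1=1$ in $\mathcal N(2)$ and $r_1=r_0$ in $\mathcal N(2\,{\rm ex})$. - $\mathcal N(3)$, $\mathcal N(4)$ and $\mathcal N(5)$ have flag set $\{0,1\}^2$, with $r_0$ and $r_2$ changing the first and the second coordinate respectively; $r_1=1$ in $\mathcal N(3)$, $r_1$ is the transposition of $(1,0)$ and $(1,1)$ in $\mathcal N(4)$, and $r_1=r_2$ in $\mathcal N(5)$. - For $T=2,\,2\,{\rm ex},\,4,\,5$, the maps for the superscripts $*$ and $P$ are $D(\mathcal N(T))$ and $P(D(\mathcal N(T)))$ respectively. Let $\mathcal G(T)$ be the set of groups isomorphic to ${\rm Aut}\,\mathcal M$ for some map $\mathcal M\in T$. **Theorem 6.1.** Let $q$ be a prime power such that $L_2(q)=PSL_2(\mathbb F_q)$ is simple, and let $T$ be one of the 14 classes. Then $L_2(q)\in\mathcal G(T)$ if and only if either $T=1$ and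 $q\neq 7,9$, or $T\in\{2^\sigma,3,4^\sigma\}$ for some $\sigma\in\{\emptyset,*,P\}$. In particular, $L_2(q)\notin\mathcal G(2^\sigma{\rm ex})$ and $L_2(q)\notin\mathcal G(5^\sigma)$ for all $\sigma$. -/

import Mathlib

universe u

/-- A (not necessarily connected) map on a surface, possibly non-orientable or with non-empty
boundary, given by its set `Φ` of flags and a permutation representation on `Φ` of the group
`⟨R₀, R₁, R₂ ∣ Rᵢ² = (R₀R₂)² = 1⟩`.  The permutation `rᵢ` changes the `i`-dimensional component of
a flag; it may fix flags (this happens at free edges and on the boundary).  Vertices, edges and faces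
are the orbits of `⟨r₁, r₂⟩`, `⟨r₀, r₂⟩` and `⟨r₀, r₁⟩`. -/
structure FlagMap (Φ : Type u) where
  r₀ : Equiv.Perm Φ
  r₁ : Equiv.Perm Φ
  r₂ : Equiv.Perm Φ
  sq₀ : r₀ ^ 2 = 1
  sq₁ : r₁ ^ 2 = 1
  sq₂ : r₂ ^ 2 = 1
  sq₀₂ : (r₀ * r₂) ^ 2 = 1

namespace FlagMap

variable {Φ : Type u}

/-- The monodromy group `⟨r₀, r₁, r₂⟩`. -/
def mon (M : FlagMap Φ) : Subgroup (Equiv.Perm Φ) :=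
  Subgroup.closure {M.r₀, M.r₁, M.r₂}

/-- The automorphism group: the centraliser of the monodromy group in `Sym Φ`. -/
def aut (M : FlagMap Φ) : Subgroup (Equiv.Perm Φ) :=
  Subgroup.centralizer (M.mon : Set (Equiv.Perm Φ))

/-- The group `⟨r₀, r₂⟩`, whose orbits on flags are the edges. -/
def edgeGroup (M : FlagMap Φ) : Subgroup (Equiv.Perm Φ) :=
  Subgroup.closure {M.r₀, M.r₂}

/-- A map is connected if it has a flag and its monodromy group is transitive on flags. -/
def Connected (M : FlagMap Φ) : Prop :=
  Nonempty Φ ∧ ∀ x y : Φ, ∃ g ∈ M.mon, g x = y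

/-- The automorphism group is transitive on edges: for any two flags `x` and `y`, some automorphism
takes the edge of `x` to the edge of `y`. -/
def EdgeTransitive (M : FlagMap Φ) : Prop :=
  ∀ x y : Φ, ∃ a ∈ M.aut, ∃ g ∈ M.edgeGroup, g (a x) = y

/-- Isomorphism of maps: a bijection of the flags commuting with the `rᵢ`. -/
def Isomorphic {Ψ : Type*} (M : FlagMap Φ) (N : FlagMap Ψ) : Prop :=
  ∃ f : Φ ≃ Ψ, (∀ x, f (M.r₀ x) = N.r₀ (f x)) ∧ (∀ x, f (M.r₁ x) = N.r₁ (f x)) ∧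
    (∀ x, f (M.r₂ x) = N.r₂ (f x))

/-- The flags of the quotient map `M / Aut M`: the orbits of `Aut M` on the flags of `M`. -/
abbrev QuotientFlags (M : FlagMap Φ) : Type u :=
  MulAction.orbitRel.Quotient M.aut Φ

theorem orbitRel_apply_iff (M : FlagMap Φ) {g : Equiv.Perm Φ} (hg : g ∈ M.mon) (x y : Φ) :
    MulAction.orbitRel M.aut Φ x y ↔ MulAction.orbitRel M.aut Φ (g x) (g y) := by
  have key : ∀ (h : Equiv.Perm Φ), h ∈ M.mon → ∀ x y : Φ,
      MulAction.orbitRel M.aut Φ x y → MulAction.orbitRel M.aut Φ (h x) (h y) := by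
    rintro h hh x y ⟨a, rfl⟩
    refine ⟨a, ?_⟩
    have := Subgroup.mem_centralizer_iff.mp a.2 h hh
    exact (congrArg (fun p : Equiv.Perm Φ => p y) this).symm
  refine ⟨key g hg x y, fun h => ?_⟩
  simpa using key g⁻¹ (M.mon.inv_mem hg) _ _ h

/-- The permutation of `M / Aut M` induced by an element of the monodromy group. -/
def quotientPerm (M : FlagMap Φ) (g : Equiv.Perm Φ) (hg : g ∈ M.mon) :
    Equiv.Perm M.QuotientFlags :=
  Quotient.congr g (M.orbitRel_apply_iff hg)

/-- The quotient map `M / Aut M`. -/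
def quotient (M : FlagMap Φ) : FlagMap M.QuotientFlags where
  r₀ := M.quotientPerm M.r₀ (Subgroup.subset_closure (by simp))
  r₁ := M.quotientPerm M.r₁ (Subgroup.subset_closure (by simp))
  r₂ := M.quotientPerm M.r₂ (Subgroup.subset_closure (by simp))
  sq₀ := by
    ext x
    induction x using Quotient.inductionOn with
    | _ x => exact congrArg (Quotient.mk _) (congrArg (fun p : Equiv.Perm Φ => p x) M.sq₀)
  sq₁ := by
    ext x
    induction x using Quotient.inductionOn with
    | _ x => exact congrArg (Quotient.mk _) (congrArg (fun p : Equiv.Perm Φ => p x) M.sq₁)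
  sq₂ := by
    ext x
    induction x using Quotient.inductionOn with
    | _ x => exact congrArg (Quotient.mk _) (congrArg (fun p : Equiv.Perm Φ => p x) M.sq₂)
  sq₀₂ := by
    ext x
    induction x using Quotient.inductionOn with
    | _ x => exact congrArg (Quotient.mk _) (congrArg (fun p : Equiv.Perm Φ => p x) M.sq₀₂)

/-- The classical dual `D(M)`: `R₀` and `R₂` are transposed. -/
def dual (M : FlagMap Φ) : FlagMap Φ where
  r₀ := M.r₂
  r₁ := M.r₁
  r₂ := M.r₀
  sq₀ := M.sq₂
  sq₁ := M.sq₁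
  sq₂ := M.sq₀
  sq₀₂ := by
    have h := M.sq₀₂
    have h₀ := M.sq₀
    have h₂ := M.sq₂
    rw [sq] at h h₀ h₂ ⊢
    have e : M.r₂ * M.r₀ = (M.r₀ * M.r₂)⁻¹ := by
      rw [mul_inv_rev, inv_eq_of_mul_eq_one_left h₀, inv_eq_of_mul_eq_one_left h₂]
    rw [e, ← mul_inv_rev, h, inv_one]

/-- The Petrie dual `P(M)`: `R₀` and `R₀R₂` are transposed, while `R₁` and `R₂` are fixed. -/
def petrie (M : FlagMap Φ) : FlagMap Φ where
  r₀ := M.r₀ * M.r₂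
  r₁ := M.r₁
  r₂ := M.r₂
  sq₀ := M.sq₀₂
  sq₁ := M.sq₁
  sq₂ := M.sq₂
  sq₀₂ := by
    have h₂ := M.sq₂
    rw [sq] at h₂
    rw [mul_assoc, h₂, mul_one, M.sq₀]

end FlagMap

/-- The superscript `σ`: the empty symbol, `*` or `P`. -/
inductive ClassSuperscript
  | empty
  | star
  | P

/-- The 14 Graver–Watkins classes of edge-transitive maps:
`1`, `2^σ`, `2^σ ex`, `3`, `4^σ`, `5^σ`. -/
inductive EdgeTransitiveClass
  | one
  | two (σ : ClassSuperscript)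
  | twoEx (σ : ClassSuperscript)
  | three
  | four (σ : ClassSuperscript)
  | five (σ : ClassSuperscript)

/-- In each of the orbits `2^σ`, `2^σ ex`, `4^σ`, `5^σ`, the duality `D` takes the first class to the
class with superscript `*`, and `P` takes the latter to the class with superscript `P`. -/
def ClassSuperscript.op {Φ : Type} : ClassSuperscript → FlagMap Φ → FlagMap Φ
  | .empty, M => M
  | .star, M => M.dual
  | .P, M => M.dual.petrie

namespace EdgeTransitiveClass

/-- The flags of the one-edge map `𝒩(T)`. -/
abbrev BasicFlags : EdgeTransitiveClass → Type
  | one => Unit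
  | two _ => Bool
  | twoEx _ => Bool
  | three => Bool × Bool
  | four _ => Bool × Bool
  | five _ => Bool × Bool

/-- `(a, b) ↦ (¬a, b)`. -/
def flip₁ : Equiv.Perm (Bool × Bool) := Equiv.prodCongr Equiv.boolNot (Equiv.refl Bool)

/-- `(a, b) ↦ (a, ¬b)`. -/
def flip₂ : Equiv.Perm (Bool × Bool) := Equiv.prodCongr (Equiv.refl Bool) Equiv.boolNot

/-- `𝒩(2)`: an edge along the boundary of a closed disc, joining two boundary vertices.  Only `r₀`
moves flags, so a flag stabiliser is generated by `R₁`, `R₁^R₀`, `R₂`. -/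
def basicTwo : FlagMap Bool where
  r₀ := Equiv.boolNot
  r₁ := 1
  r₂ := 1
  sq₀ := by decide
  sq₁ := by decide
  sq₂ := by decide
  sq₀₂ := by decide

/-- `𝒩(2 ex)`: a loop along the whole boundary of a closed disc.  A flag stabiliser is generated by
`R₂` and `R₀R₁`. -/
def basicTwoEx : FlagMap Bool where
  r₀ := Equiv.boolNot
  r₁ := Equiv.boolNot
  r₂ := 1
  sq₀ := by decide
  sq₁ := by decide
  sq₂ := by decide
  sq₀₂ := by decide

/-- `𝒩(3)`: an edge across a closed disc, joining two boundary vertices.  A flag stabiliser is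
generated by `R₁`, `R₁^R₀`, `R₁^R₂`, `R₁^(R₀R₂)`. -/
def basicThree : FlagMap (Bool × Bool) where
  r₀ := flip₁
  r₁ := 1
  r₂ := flip₂
  sq₀ := by decide
  sq₁ := by decide
  sq₂ := by decide
  sq₀₂ := by decide

/-- `𝒩(4)`: an edge in a closed disc, joining an interior vertex (with flags `(true, _)`) to a boundary
vertex (with flags `(false, _)`).  The stabiliser of the flag `(false, false)` is generated by `R₁`,
`R₁^R₂`, `(R₁R₂)^R₀`. -/
def basicFour : FlagMap (Bool × Bool) where
  r₀ := flip₁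
  r₁ := Equiv.swap (true, false) (true, true)
  r₂ := flip₂
  sq₀ := by decide
  sq₁ := by decide
  sq₂ := by decide
  sq₀₂ := by decide

/-- `𝒩(5)`: an edge joining two vertices in the sphere.  A flag stabiliser is generated by `R₁R₂` and
`(R₁R₂)^R₀`. -/
def basicFive : FlagMap (Bool × Bool) where
  r₀ := flip₁
  r₁ := flip₂
  r₂ := flip₂
  sq₀ := by decide
  sq₁ := by decide
  sq₂ := by decide
  sq₀₂ := by decide

/-- The basic map `𝒩(T)`, the map with one edge labelling the class `T`.  The map `𝒩(1)` has a
single flag. -/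
def basicMap : (T : EdgeTransitiveClass) → FlagMap T.BasicFlags
  | one => ⟨1, 1, 1, one_pow 2, one_pow 2, one_pow 2, by decide⟩
  | two σ => σ.op basicTwo
  | twoEx σ => σ.op basicTwoEx
  | three => basicThree
  | four σ => σ.op basicFour
  | five σ => σ.op basicFive

/-- `M ∈ T`: the map `M` is connected and edge-transitive, and `M / Aut M ≅ 𝒩(T)`. -/
def Contains {Φ : Type u} (T : EdgeTransitiveClass) (M : FlagMap Φ) : Prop :=
  M.Connected ∧ M.EdgeTransitive ∧ M.quotient.Isomorphic T.basicMap

/-- `G ∈ 𝒢(T)`: the group `G` is isomorphic to `Aut M` for some map `M ∈ T`.  A connected map has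
countably many flags, so it loses nothing to take the flags in `Type`. -/
def Realises (T : EdgeTransitiveClass) (G : Type u) [Group G] : Prop :=
  ∃ (Φ : Type) (M : FlagMap Φ), T.Contains M ∧ Nonempty (G ≃* M.aut)

end EdgeTransitiveClass

-- Automorphisms of a connected map act freely on flags. A map `M` with `M / Aut M ≅ N` is therefore
-- a regular cover of `N`: its flags are `G × X`, where `G = Aut M` and `X` is the flag set of `N`,
-- and the `rᵢ` carry voltages in `G`. Conversely, a voltage assignment realises `G` over `N` when
-- the voltages of closed walks generate `G` and no automorphism moves the base fibre. Duality and
-- Petrie duality preserve `Aut` and the edges, so the superscript `σ` plays no role and six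
-- quotients remain.
--
-- Class 1 amounts to generation of `G` by `r₀, r₁, r₂` of order at most two with `r₀, r₂`
-- commuting. For the classes 2, 3 and 4 it suffices that `G` is generated by three involutions `x,
-- y, z` for which some power kills `zx` but not `zy`; the asymmetry prevents symmetries of the
-- quotient from lifting. In a non-abelian simple group the first condition implies the second, with
-- exponent 2.
--
-- For 2 ex and 5, `G` is generated by two elements, and a reflection of the quotient lifts as soon
-- as some automorphism of `G` inverts both. In `PSL₂(F)` this always happens: if `A, B` generate,
-- then `N = AB - BA` satisfies `ANA = N = BNB`, so conjugation by `N` inverts both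
-- (`generatingPairsInvertible`). The lift contradicts the definition of the quotient.
--
-- It remains to decide when `PSL₂(q)` satisfies the class 1 condition. If `q = 8` or `q ≥ 16`, two
-- involutions with product a generator of the split torus and a third without zero entries generate
-- (`eq_top_of_torus`). The other small fields, and the asymmetric triples for 7 and 9, are handled
-- by words giving unipotents.
--
-- For `q = 7, 9` the class 1 condition fails. Commuting involutions lift to anticommuting square
-- roots `I, J` of `-1`, and all three involutions act on pure quaternions as half-turns about unit
-- axes, two of them coordinate axes. Each third axis admits a set of 2, 6 or 12 non-isotropic
-- vectors stable under all three half-turns. If they generated, the unipotents would act freely on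
-- that set, and `q` would divide its size (`exists_unit_card_dvd`).

universe v

/-! ### Automorphisms, quotients and duality -/

namespace FlagMap

theorem mem_aut_iff {Φ : Type u} (M : FlagMap Φ) (a : Equiv.Perm Φ) :
    a ∈ M.aut ↔ (∀ x, a (M.r₀ x) = M.r₀ (a x)) ∧ (∀ x, a (M.r₁ x) = M.r₁ (a x)) ∧
      (∀ x, a (M.r₂ x) = M.r₂ (a x)) := by
  unfold aut mon
  rw [Subgroup.centralizer_closure, Subgroup.mem_centralizer_iff]
  simp only [Set.mem_insert_iff, Set.mem_singleton_iff, forall_eq_or_imp, forall_eq]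
  simp only [Equiv.ext_iff, Equiv.Perm.mul_apply, eq_comm]

theorem r₀_mem_mon {Φ : Type u} (M : FlagMap Φ) : M.r₀ ∈ M.mon :=
  Subgroup.subset_closure (by simp)

theorem r₁_mem_mon {Φ : Type u} (M : FlagMap Φ) : M.r₁ ∈ M.mon :=
  Subgroup.subset_closure (by simp)

theorem r₂_mem_mon {Φ : Type u} (M : FlagMap Φ) : M.r₂ ∈ M.mon :=
  Subgroup.subset_closure (by simp)

theorem aut_apply_comm {Φ : Type u} (M : FlagMap Φ) {a : Equiv.Perm Φ} (ha : a ∈ M.aut)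
    {w : Equiv.Perm Φ} (hw : w ∈ M.mon) (x : Φ) : a (w x) = w (a x) :=
  (congrArg (fun p : Equiv.Perm Φ => p x) (Subgroup.mem_centralizer_iff.mp ha w hw)).symm

/-- The freeness of the automorphism group on flags: automorphisms commute with a transitive group,
so one value determines the rest. -/
theorem Connected.aut_ext {Φ : Type u} {M : FlagMap Φ} (hM : M.Connected) {a b : Equiv.Perm Φ}
    (ha : a ∈ M.aut) (hb : b ∈ M.aut) {x : Φ} (h : a x = b x) : a = b := by
  ext y
  obtain ⟨w, hw, rfl⟩ := hM.2 x y
  rw [M.aut_apply_comm ha hw, M.aut_apply_comm hb hw, h]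

theorem r₀_r₀ {Φ : Type u} (M : FlagMap Φ) (x : Φ) : M.r₀ (M.r₀ x) = x := by
  simpa [sq] using congrArg (fun p : Equiv.Perm Φ => p x) M.sq₀

theorem r₁_r₁ {Φ : Type u} (M : FlagMap Φ) (x : Φ) : M.r₁ (M.r₁ x) = x := by
  simpa [sq] using congrArg (fun p : Equiv.Perm Φ => p x) M.sq₁

theorem r₂_r₂ {Φ : Type u} (M : FlagMap Φ) (x : Φ) : M.r₂ (M.r₂ x) = x := by
  simpa [sq] using congrArg (fun p : Equiv.Perm Φ => p x) M.sq₂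

theorem r₂_r₀ {Φ : Type u} (M : FlagMap Φ) (x : Φ) : M.r₂ (M.r₀ x) = M.r₀ (M.r₂ x) := by
  have h := congrArg (fun p : Equiv.Perm Φ => p x) M.sq₀₂
  simp only [sq, Equiv.Perm.mul_apply, Equiv.Perm.one_apply] at h
  have h2 := congrArg (fun y => M.r₂ (M.r₀ y)) h
  simpa [r₀_r₀, r₂_r₂] using h2.symm

/-- A set of flags stable under the `rᵢ` is everything, if the map is connected. -/
theorem Connected.induction {Φ : Type u} {M : FlagMap Φ} (hM : M.Connected) (P : Φ → Prop)
    (h₀ : ∀ x, P x → P (M.r₀ x)) (h₁ : ∀ x, P x → P (M.r₁ x)) (h₂ : ∀ x, P x → P (M.r₂ x))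
    {x : Φ} (hx : P x) (y : Φ) : P y := by
  obtain ⟨w, hw, rfl⟩ := hM.2 x y
  have key : ∀ z, P z ↔ P (w z) := by
    unfold mon at hw
    induction hw using Subgroup.closure_induction with
    | mem r hr =>
      intro z
      rcases hr with rfl | rfl | rfl
      · exact ⟨h₀ z, fun h => by simpa [r₀_r₀] using h₀ _ h⟩
      · exact ⟨h₁ z, fun h => by simpa [r₁_r₁] using h₁ _ h⟩
      · exact ⟨h₂ z, fun h => by simpa [r₂_r₂] using h₂ _ h⟩
    | one => simp
    | mul a b _ _ ha hb => intro z; rw [hb z, ha (b z)]; rfl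
    | inv a _ ha => intro z; rw [ha (a⁻¹ z)]; simp
  exact (key x).mp hx

/-- `f` is the projection of `M` onto a copy `N` of its quotient `M / Aut M`. -/
def IsAutQuotient {Φ : Type u} {Ψ : Type v} (M : FlagMap Φ) (N : FlagMap Ψ) (f : Φ → Ψ) : Prop :=
  f.Surjective ∧ (∀ x, f (M.r₀ x) = N.r₀ (f x)) ∧ (∀ x, f (M.r₁ x) = N.r₁ (f x)) ∧
    (∀ x, f (M.r₂ x) = N.r₂ (f x)) ∧ ∀ x y, f x = f y ↔ ∃ a ∈ M.aut, a x = y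

/-- Trades the type of orbits for a projection onto the basic map, so that later arguments work with
flags directly. -/
theorem quotient_isomorphic_iff {Φ : Type u} {Ψ : Type v} (M : FlagMap Φ) (N : FlagMap Ψ) :
    M.quotient.Isomorphic N ↔ ∃ f : Φ → Ψ, M.IsAutQuotient N f := by
  have hrel : ∀ x y, (Quotient.mk (MulAction.orbitRel M.aut Φ) x = Quotient.mk _ y) ↔
      ∃ a ∈ M.aut, a x = y := by
    intro x y
    rw [Quotient.eq]
    constructor
    · rintro ⟨a, rfl⟩
      exact ⟨a⁻¹, M.aut.inv_mem a.2, by simp [Subgroup.smul_def]⟩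
    · rintro ⟨a, ha, rfl⟩
      exact ⟨⟨a⁻¹, M.aut.inv_mem ha⟩, by simp [Subgroup.smul_def]⟩
  constructor
  · rintro ⟨e, h₀, h₁, h₂⟩
    refine ⟨fun x => e (Quotient.mk _ x), e.surjective.comp Quotient.mk_surjective,
      fun x => h₀ (Quotient.mk _ x), fun x => h₁ (Quotient.mk _ x), fun x => h₂ (Quotient.mk _ x),
      fun x y => ?_⟩
    rw [e.injective.eq_iff, hrel]
  · rintro ⟨f, hf, h₀, h₁, h₂, hr⟩
    let g : M.QuotientFlags → Ψ := Quotient.lift f (fun x y h => by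
      rw [hr, ← hrel]; exact Quotient.sound h)
    have hg : Function.Bijective g := by
      constructor
      · intro x y
        induction x using Quotient.inductionOn with
        | _ x => induction y using Quotient.inductionOn with
          | _ y => intro h; exact (hrel x y).mpr ((hr x y).mp h)
      · intro y
        obtain ⟨x, rfl⟩ := hf y
        exact ⟨Quotient.mk _ x, rfl⟩
    refine ⟨Equiv.ofBijective g hg, ?_, ?_, ?_⟩ <;> intro x <;>
      induction x using Quotient.inductionOn with
      | _ x => first | exact h₀ x | exact h₁ x | exact h₂ x

theorem mon_dual {Φ : Type u} (M : FlagMap Φ) : M.dual.mon = M.mon := by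
  unfold mon dual
  congr 1
  ext x
  simp only [Set.mem_insert_iff, Set.mem_singleton_iff]
  tauto

theorem edgeGroup_dual {Φ : Type u} (M : FlagMap Φ) : M.dual.edgeGroup = M.edgeGroup := by
  unfold edgeGroup dual
  rw [Set.pair_comm]

theorem edgeGroup_petrie {Φ : Type u} (M : FlagMap Φ) : M.petrie.edgeGroup = M.edgeGroup := by
  unfold edgeGroup petrie
  apply le_antisymm
  · rw [Subgroup.closure_le]
    rintro x (rfl | rfl)
    · exact mul_mem (Subgroup.subset_closure (by simp)) (Subgroup.subset_closure (by simp))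
    · exact Subgroup.subset_closure (by simp)
  · rw [Subgroup.closure_le]
    rintro x (rfl | rfl)
    · have h2 : M.r₂ * M.r₂ = 1 := by rw [← sq, M.sq₂]
      have : M.r₀ = (M.r₀ * M.r₂) * M.r₂ := by rw [mul_assoc, h2, mul_one]
      refine (congrArg (· ∈ _) this).mpr ?_
      exact mul_mem (Subgroup.subset_closure (by simp)) (Subgroup.subset_closure (by simp))
    · exact Subgroup.subset_closure (by simp)

theorem mon_eq_sup {Φ : Type u} (M : FlagMap Φ) :
    M.mon = M.edgeGroup ⊔ Subgroup.closure {M.r₁} := by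
  unfold mon edgeGroup
  rw [← Subgroup.closure_union]
  congr 1
  ext x
  simp only [Set.mem_insert_iff, Set.mem_singleton_iff, Set.mem_union]
  tauto

theorem mon_petrie {Φ : Type u} (M : FlagMap Φ) : M.petrie.mon = M.mon := by
  rw [mon_eq_sup, edgeGroup_petrie, mon_eq_sup]
  rfl

theorem aut_dual {Φ : Type u} (M : FlagMap Φ) : M.dual.aut = M.aut := by
  unfold aut; rw [mon_dual]

theorem aut_petrie {Φ : Type u} (M : FlagMap Φ) : M.petrie.aut = M.aut := by
  unfold aut; rw [mon_petrie]

theorem Connected.dual {Φ : Type u} {M : FlagMap Φ} (h : M.Connected) : M.dual.Connected := by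
  unfold Connected; rw [mon_dual]; exact h

theorem Connected.petrie {Φ : Type u} {M : FlagMap Φ} (h : M.Connected) : M.petrie.Connected := by
  unfold Connected; rw [mon_petrie]; exact h

theorem EdgeTransitive.dual {Φ : Type u} {M : FlagMap Φ} (h : M.EdgeTransitive) :
    M.dual.EdgeTransitive := by
  unfold EdgeTransitive; rw [aut_dual, edgeGroup_dual]; exact h

theorem EdgeTransitive.petrie {Φ : Type u} {M : FlagMap Φ} (h : M.EdgeTransitive) :
    M.petrie.EdgeTransitive := by
  unfold EdgeTransitive; rw [aut_petrie, edgeGroup_petrie]; exact h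

theorem IsAutQuotient.dual {Φ : Type u} {Ψ : Type v} {M : FlagMap Φ} {N : FlagMap Ψ} {f : Φ → Ψ}
    (h : M.IsAutQuotient N f) : M.dual.IsAutQuotient N.dual f := by
  obtain ⟨hf, h₀, h₁, h₂, hr⟩ := h
  exact ⟨hf, h₂, h₁, h₀, by rw [aut_dual]; exact hr⟩

theorem IsAutQuotient.petrie {Φ : Type u} {Ψ : Type v} {M : FlagMap Φ} {N : FlagMap Ψ} {f : Φ → Ψ}
    (h : M.IsAutQuotient N f) : M.petrie.IsAutQuotient N.petrie f := by
  obtain ⟨hf, h₀, h₁, h₂, hr⟩ := h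
  refine ⟨hf, fun x => ?_, h₁, h₂, by rw [aut_petrie]; exact hr⟩
  change f (M.r₀ (M.r₂ x)) = N.r₀ (N.r₂ (f x))
  rw [h₀, h₂]

theorem petrie_petrie {Φ : Type u} (M : FlagMap Φ) : M.petrie.petrie = M := by
  have h : M.r₀ * M.r₂ * M.r₂ = M.r₀ := by rw [mul_assoc, ← sq, M.sq₂, mul_one]
  cases M
  simp only [petrie, FlagMap.mk.injEq, and_true]
  exact h

/-- The group `G` is the automorphism group of a connected edge-transitive map with quotient `N`. -/
def RealisedOver {Ψ : Type v} (N : FlagMap Ψ) (G : Type u) [Group G] : Prop :=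
  ∃ (Φ : Type) (M : FlagMap Φ), M.Connected ∧ M.EdgeTransitive ∧ (∃ f, M.IsAutQuotient N f) ∧
    Nonempty (G ≃* M.aut)

theorem RealisedOver.dual {Ψ : Type v} {N : FlagMap Ψ} {G : Type u} [Group G]
    (h : N.RealisedOver G) : N.dual.RealisedOver G := by
  obtain ⟨Φ, M, hc, he, ⟨f, hf⟩, ⟨e⟩⟩ := h
  exact ⟨Φ, M.dual, hc.dual, he.dual, ⟨f, hf.dual⟩,
    ⟨e.trans (MulEquiv.subgroupCongr M.aut_dual.symm)⟩⟩

theorem RealisedOver.petrie {Ψ : Type v} {N : FlagMap Ψ} {G : Type u} [Group G]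
    (h : N.RealisedOver G) : N.petrie.RealisedOver G := by
  obtain ⟨Φ, M, hc, he, ⟨f, hf⟩, ⟨e⟩⟩ := h
  exact ⟨Φ, M.petrie, hc.petrie, he.petrie, ⟨f, hf.petrie⟩,
    ⟨e.trans (MulEquiv.subgroupCongr M.aut_petrie.symm)⟩⟩

/-- Both operations are involutions and change neither the automorphism group nor the edges, so the
superscript can be dropped. -/
theorem RealisedOver.op_iff {Ψ : Type} {N : FlagMap Ψ} {G : Type u} [Group G]
    (σ : ClassSuperscript) : (σ.op N).RealisedOver G ↔ N.RealisedOver G := by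
  cases σ with
  | empty => rfl
  | star => exact ⟨fun h => h.dual, fun h => h.dual⟩
  | P =>
    refine ⟨fun h => ?_, fun h => h.dual.petrie⟩
    have h' := h.petrie.dual
    simp only [ClassSuperscript.op, petrie_petrie] at h'
    exact h'

theorem RealisedOver.of_mulEquiv {Ψ : Type v} {N : FlagMap Ψ} {G : Type u} [Group G]
    {G' : Type*} [Group G'] (e : G' ≃* G) (h : N.RealisedOver G) : N.RealisedOver G' := by
  obtain ⟨Φ, M, hc, he, hf, ⟨e'⟩⟩ := h
  exact ⟨Φ, M, hc, he, hf, ⟨e.trans e'⟩⟩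

end FlagMap

theorem EdgeTransitiveClass.realises_iff (T : EdgeTransitiveClass) (G : Type u) [Group G] :
    T.Realises G ↔ T.basicMap.RealisedOver G := by
  unfold EdgeTransitiveClass.Realises EdgeTransitiveClass.Contains FlagMap.RealisedOver
  simp only [FlagMap.quotient_isomorphic_iff, and_assoc]

/-! ### Voltage covers -/

namespace FlagMap

section Voltage

variable {G : Type u} [Group G] {X : Type v}

/-- The involution of `G × X` covering an involution `s` of `X`, with voltages `c`. -/
def voltagePerm (s : Equiv.Perm X) (c : X → G) (hs : ∀ x, s (s x) = x)
    (hc : ∀ x, c x * c (s x) = 1) : Equiv.Perm (G × X) :=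
  Function.Involutive.toPerm (fun p => (p.1 * c p.2, s p.2)) (fun p => by
    simp [mul_assoc, hs, hc])

@[simp]
theorem voltagePerm_apply (s : Equiv.Perm X) (c : X → G) (hs : ∀ x, s (s x) = x)
    (hc : ∀ x, c x * c (s x) = 1) (h : G) (x : X) :
    voltagePerm s c hs hc (h, x) = (h * c x, s x) := rfl

/-- The covering map of `N` with flag set `G × X`, where `r₀` and `r₂` carry constant voltages. -/
def voltageMap (N : FlagMap X) (c₀ c₂ : G) (v : X → G) (h₀ : c₀ * c₀ = 1) (h₂ : c₂ * c₂ = 1)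
    (h₀₂ : c₀ * c₂ = c₂ * c₀) (hv : ∀ x, v x * v (N.r₁ x) = 1) : FlagMap (G × X) where
  r₀ := voltagePerm N.r₀ (fun _ => c₀) N.r₀_r₀ (fun _ => h₀)
  r₁ := voltagePerm N.r₁ v N.r₁_r₁ hv
  r₂ := voltagePerm N.r₂ (fun _ => c₂) N.r₂_r₂ (fun _ => h₂)
  sq₀ := by ext ⟨h, x⟩ <;> simp [sq, mul_assoc, h₀, r₀_r₀]
  sq₁ := by ext ⟨h, x⟩ <;> simp [sq, mul_assoc, hv, r₁_r₁]
  sq₂ := by ext ⟨h, x⟩ <;> simp [sq, mul_assoc, h₂, r₂_r₂]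
  sq₀₂ := by
    ext ⟨h, x⟩
    · have : c₂ * (c₀ * (c₂ * c₀)) = 1 := by
        rw [← h₀₂, ← mul_assoc c₀, h₀, one_mul, h₂]
      simp [sq, mul_assoc, this]
    · simp [sq, r₂_r₀, r₂_r₂, r₀_r₀]

variable (N : FlagMap X) (c₀ c₂ : G) (v : X → G) (h₀ : c₀ * c₀ = 1) (h₂ : c₂ * c₂ = 1)
    (h₀₂ : c₀ * c₂ = c₂ * c₀) (hv : ∀ x, v x * v (N.r₁ x) = 1)

@[simp]
theorem voltageMap_r₀ (h : G) (x : X) :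
    (voltageMap N c₀ c₂ v h₀ h₂ h₀₂ hv).r₀ (h, x) = (h * c₀, N.r₀ x) := rfl

@[simp]
theorem voltageMap_r₁ (h : G) (x : X) :
    (voltageMap N c₀ c₂ v h₀ h₂ h₀₂ hv).r₁ (h, x) = (h * v x, N.r₁ x) := rfl

@[simp]
theorem voltageMap_r₂ (h : G) (x : X) :
    (voltageMap N c₀ c₂ v h₀ h₂ h₀₂ hv).r₂ (h, x) = (h * c₂, N.r₂ x) := rfl

/-- Left translation by `g`, as a permutation of `G × X`. -/
def translation (g : G) : Equiv.Perm (G × X) := (Equiv.mulLeft g).prodCongr (Equiv.refl X)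

@[simp]
theorem translation_apply (g h : G) (x : X) : translation g (h, x) = (g * h, x) := rfl

theorem translation_mem_aut (g : G) :
    translation g ∈ (voltageMap N c₀ c₂ v h₀ h₂ h₀₂ hv).aut := by
  rw [mem_aut_iff]
  refine ⟨?_, ?_, ?_⟩ <;> rintro ⟨h, x⟩ <;> simp [mul_assoc]

theorem pow_apply_of_voltage {W : Equiv.Perm (G × X)} {x : X} {k : G}
    (hW : ∀ h, W (h, x) = (h * k, x)) (n : ℕ) (h : G) : (W ^ n) (h, x) = (h * k ^ n, x) := by
  induction n generalizing h with
  | zero => simp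
  | succ n ih => rw [pow_succ, Equiv.Perm.mul_apply, hW, ih, pow_succ', mul_assoc]

/-- An automorphism taking the fibre of `x` to that of `y` respects the orders of the voltages
of a closed walk. -/
theorem voltage_pow_eq_one {M : FlagMap (G × X)} {a W : Equiv.Perm (G × X)} (ha : a ∈ M.aut)
    (hW : W ∈ M.mon) {g : G} {x y : X} {k l : G} (hx : ∀ h, W (h, x) = (h * k, x))
    (hy : ∀ h, W (h, y) = (h * l, y)) {n : ℕ} (hk : k ^ n = 1) (hg : (a (g, x)).2 = y) :
    l ^ n = 1 := by
  have h := M.aut_apply_comm ha (pow_mem hW n) (g, x)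
  have e : a (g, x) = ((a (g, x)).1, y) := Prod.ext rfl hg
  rw [pow_apply_of_voltage hx, hk, mul_one, e, pow_apply_of_voltage hy] at h
  simpa using h

end Voltage

/-- Left translations are automorphisms, simply transitive on each fibre. By `hgen` the closed walks
at `x₀` reach its whole fibre, and by `hX` there is only one edge below, so the cover is connected
and edge-transitive. By `hrigid` an automorphism agrees with some translation at `(1, x₀)`, hence
everywhere. -/
theorem realisedOver_of_voltageMap {G : Type} [Group G] {X : Type} {N : FlagMap X} {c₀ c₂ : G}
    {v : X → G} {h₀ : c₀ * c₀ = 1} {h₂ : c₂ * c₂ = 1} {h₀₂ : c₀ * c₂ = c₂ * c₀}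
    {hv : ∀ x, v x * v (N.r₁ x) = 1} (x₀ : X)
    (hX : ∀ x, x = x₀ ∨ x = N.r₀ x₀ ∨ x = N.r₂ x₀ ∨ x = N.r₀ (N.r₂ x₀)) (S : Set G)
    (hS : Subgroup.closure S = ⊤)
    (hgen : ∀ s ∈ S, ∃ w ∈ (voltageMap N c₀ c₂ v h₀ h₂ h₀₂ hv).mon, ∀ h, w (h, x₀) = (h * s, x₀))
    (hrigid : ∀ a ∈ (voltageMap N c₀ c₂ v h₀ h₂ h₀₂ hv).aut, ∀ g, (a (g, x₀)).2 = x₀) :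
    N.RealisedOver G := by
  set M := voltageMap N c₀ c₂ v h₀ h₂ h₀₂ hv with hM
  have hbase : ∀ g : G, ∃ w ∈ M.mon, ∀ h, w (h, x₀) = (h * g, x₀) := by
    intro g
    have hg : g ∈ Subgroup.closure S := hS ▸ Subgroup.mem_top g
    induction hg using Subgroup.closure_induction with
    | mem s hs => exact hgen s hs
    | one => exact ⟨1, one_mem _, by simp⟩
    | mul a b _ _ ha hb =>
      obtain ⟨w, hw, hwa⟩ := ha
      obtain ⟨w', hw', hwb⟩ := hb
      exact ⟨w' * w, mul_mem hw' hw, fun h => by simp [hwa, hwb, mul_assoc]⟩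
    | inv a _ ha =>
      obtain ⟨w, hw, hwa⟩ := ha
      exact ⟨w⁻¹, inv_mem hw, fun h => by rw [Equiv.Perm.inv_eq_iff_eq, hwa]; simp⟩
  have hedge : ∀ y : G × X, ∃ g : G, ∃ w ∈ M.edgeGroup, w (g, x₀) = y := by
    rintro ⟨h, x⟩
    have m₀ : M.r₀ ∈ M.edgeGroup := Subgroup.subset_closure (by simp)
    have m₂ : M.r₂ ∈ M.edgeGroup := Subgroup.subset_closure (by simp)
    rcases hX x with rfl | rfl | rfl | rfl
    · exact ⟨h, 1, one_mem _, rfl⟩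
    · exact ⟨h * c₀⁻¹, M.r₀, m₀, by simp [hM]⟩
    · exact ⟨h * c₂⁻¹, M.r₂, m₂, by simp [hM]⟩
    · exact ⟨h * c₀⁻¹ * c₂⁻¹, M.r₀ * M.r₂, mul_mem m₀ m₂, by simp [hM]⟩
  have hle : M.edgeGroup ≤ M.mon := by rw [mon_eq_sup]; exact le_sup_left
  have hreach : ∀ y : G × X, ∃ w ∈ M.mon, w (1, x₀) = y := by
    intro y
    obtain ⟨g, w, hw, rfl⟩ := hedge y
    obtain ⟨w', hw', h⟩ := hbase g
    exact ⟨w * w', mul_mem (hle hw) hw', by simp [h]⟩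
  have hconn : M.Connected := by
    refine ⟨⟨(1, x₀)⟩, fun x y => ?_⟩
    obtain ⟨w, hw, rfl⟩ := hreach x
    obtain ⟨w', hw', rfl⟩ := hreach y
    exact ⟨w' * w⁻¹, mul_mem hw' (inv_mem hw), by simp⟩
  have htrans : ∀ g, translation g ∈ M.aut := fun g => translation_mem_aut N c₀ c₂ v h₀ h₂ h₀₂ hv g
  have hsurj : ∀ a ∈ M.aut, a = translation (a (1, x₀)).1 := fun a ha =>
    hconn.aut_ext ha (htrans _) (x := (1, x₀)) (by ext <;> simp [hrigid a ha])
  refine ⟨G × X, M, hconn, ?_, ⟨Prod.snd, ?_, ?_, ?_, ?_, ?_⟩, ?_⟩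
  · intro x y
    obtain ⟨g, w, hw, rfl⟩ := hedge x
    obtain ⟨g', w', hw', rfl⟩ := hedge y
    refine ⟨translation (g' * g⁻¹), htrans _, w' * w⁻¹, mul_mem hw' (inv_mem hw), ?_⟩
    rw [M.aut_apply_comm (htrans _) (hle hw)]
    simp
  · exact fun x => ⟨(1, x), rfl⟩
  · rintro ⟨h, x⟩; rfl
  · rintro ⟨h, x⟩; rfl
  · rintro ⟨h, x⟩; rfl
  · rintro ⟨h, x⟩ ⟨k, y⟩
    constructor
    · rintro rfl
      exact ⟨translation (k * h⁻¹), htrans _, by simp⟩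
    · rintro ⟨a, ha, hxy⟩
      rw [hsurj a ha] at hxy
      have h2 := congrArg Prod.snd hxy
      exact h2
  · let L : G →* M.aut :=
      { toFun := fun g => ⟨translation g, htrans g⟩
        map_one' := by ext ⟨h, x⟩ <;> simp
        map_mul' := fun a b => by ext ⟨h, x⟩ <;> simp [mul_assoc] }
    refine ⟨MulEquiv.ofBijective L ⟨fun a b h => ?_, fun a => ⟨(a.1 (1, x₀)).1, ?_⟩⟩⟩
    · have := congrArg (fun p : M.aut => (p.1 (1, x₀)).1) h
      simpa [L] using this
    · exact Subtype.ext (hsurj a.1 a.2).symm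

end FlagMap

/-! ### Generating sets which realise a group in the classes 1, 2, 3, 4 -/

section

open FlagMap

/-- `G` is generated by three involutions `x, y, z`, for which the orders of `zx` and `zy`
are different: `zx` has order dividing `n`, unlike `zy`. -/
def GeneratedByAsymmetricInvolutions (G : Type u) [Group G] : Prop :=
  ∃ (x y z : G) (n : ℕ), x * x = 1 ∧ y * y = 1 ∧ z * z = 1 ∧ x ≠ 1 ∧ y ≠ 1 ∧ z ≠ 1 ∧
    Subgroup.closure {x, y, z} = ⊤ ∧ (z * x) ^ n = 1 ∧ (z * y) ^ n ≠ 1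

/-- `G` is generated by `r₀, r₁, r₂` of order at most two, with `r₀` and `r₂` commuting. -/
def GeneratedByFlagReflections (G : Type u) [Group G] : Prop :=
  ∃ r₀ r₁ r₂ : G, r₀ * r₀ = 1 ∧ r₁ * r₁ = 1 ∧ r₂ * r₂ = 1 ∧ r₀ * r₂ = r₂ * r₀ ∧
    Subgroup.closure {r₀, r₁, r₂} = ⊤

theorem GeneratedByAsymmetricInvolutions.of_mulEquiv {G : Type u} [Group G] {H : Type v} [Group H]
    (e : G ≃* H) (h : GeneratedByAsymmetricInvolutions G) : GeneratedByAsymmetricInvolutions H := by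
  obtain ⟨x, y, z, n, hx, hy, hz, hx', hy', hz', hc, h1, h2⟩ := h
  refine ⟨e x, e y, e z, n, ?_, ?_, ?_, ?_, ?_, ?_, ?_, ?_, ?_⟩
  · rw [← map_mul, hx, map_one]
  · rw [← map_mul, hy, map_one]
  · rw [← map_mul, hz, map_one]
  · simpa using hx'
  · simpa using hy'
  · simpa using hz'
  · have := congrArg (Subgroup.map e.toMonoidHom) hc
    rw [MonoidHom.map_closure, Subgroup.map_top_of_surjective _ e.surjective] at this
    simpa [Set.image_insert_eq] using this
  · rw [← map_mul, ← map_pow, h1, map_one]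
  · rw [← map_mul, ← map_pow]
    exact fun h => h2 (e.injective (by rw [h, map_one]))

theorem GeneratedByFlagReflections.of_mulEquiv {G : Type u} [Group G] {H : Type v} [Group H]
    (e : G ≃* H) (h : GeneratedByFlagReflections G) : GeneratedByFlagReflections H := by
  obtain ⟨x, y, z, hx, hy, hz, h1, hc⟩ := h
  refine ⟨e x, e y, e z, ?_, ?_, ?_, ?_, ?_⟩
  · rw [← map_mul, hx, map_one]
  · rw [← map_mul, hy, map_one]
  · rw [← map_mul, hz, map_one]
  · rw [← map_mul, h1, map_mul]
  · have := congrArg (Subgroup.map e.toMonoidHom) hc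
    rw [MonoidHom.map_closure, Subgroup.map_top_of_surjective _ e.surjective] at this
    simpa [Set.image_insert_eq] using this

theorem mul_pow_eq_one_comm {G : Type u} [Group G] (a b : G) (n : ℕ) :
    (a * b) ^ n = 1 ↔ (b * a) ^ n = 1 := by
  have e : b * a = b * (a * b) * b⁻¹ := by group
  rw [e, conj_pow, conj_eq_one_iff]

namespace EdgeTransitiveClass

theorem realisedOver_basicMap_one {G : Type u} [Group G] [Small.{0} G]
    (hG : GeneratedByFlagReflections G) : (basicMap .one).RealisedOver G := by
  -- The flags must form a type in the lowest universe, so the group is replaced by a small copy;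
  -- the same reduction opens the next three proofs.
  suffices h : ∀ (H : Type) [Group H], GeneratedByFlagReflections H →
      (basicMap .one).RealisedOver H from
    (h (Shrink.{0} G) (hG.of_mulEquiv Shrink.mulEquiv.symm)).of_mulEquiv Shrink.mulEquiv.symm
  clear hG
  rintro H _ ⟨a, b, c, ha, hb, hc, hac, hcl⟩
  refine realisedOver_of_voltageMap (N := basicMap .one) (c₀ := a) (c₂ := c) (v := fun _ => b)
    (h₀ := ha) (h₂ := hc) (h₀₂ := hac) (hv := fun _ => hb) () (fun x => Or.inl rfl) _ hcl ?_
    (fun _ _ _ => rfl)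
  rintro s (rfl | rfl | rfl)
  · exact ⟨_, r₀_mem_mon _, fun h => rfl⟩
  · exact ⟨_, r₁_mem_mon _, fun h => rfl⟩
  · exact ⟨_, r₂_mem_mon _, fun h => rfl⟩

/-- The walks `R₁`, `R₁^R₀`, `R₂` at the base flag get voltages `x, y, z`. An automorphism
exchanging the fibres would carry the closed walk with voltage `zx` to the one with voltage `zy`,
against the choice of `n`. -/
theorem realisedOver_basicTwo {G : Type u} [Group G] [Small.{0} G]
    (hG : GeneratedByAsymmetricInvolutions G) : basicTwo.RealisedOver G := by
  suffices h : ∀ (H : Type) [Group H], GeneratedByAsymmetricInvolutions H →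
      basicTwo.RealisedOver H from
    (h (Shrink.{0} G) (hG.of_mulEquiv Shrink.mulEquiv.symm)).of_mulEquiv Shrink.mulEquiv.symm
  clear hG
  rintro H _ ⟨x, y, z, n, hx, hy, hz, -, -, -, hcl, h1, h2⟩
  refine realisedOver_of_voltageMap (N := basicTwo) (c₀ := 1) (c₂ := z)
    (v := fun p => if p then y else x)
    (h₀ := one_mul 1) (h₂ := hz) (h₀₂ := by simp) (hv := ?_) false ?_ _ hcl ?_ ?_
  · rintro (_ | _) <;> simpa [basicTwo]
  · decide
  · rintro s (rfl | rfl | rfl)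
    · exact ⟨_, r₁_mem_mon _, fun h => by simp [basicTwo]⟩
    · exact ⟨_, mul_mem (r₀_mem_mon _) (mul_mem (r₁_mem_mon _) (r₀_mem_mon _)),
        fun h => by simp [basicTwo]⟩
    · exact ⟨_, r₂_mem_mon _, fun h => by simp [basicTwo]⟩
  · intro a ha g
    by_contra hne
    refine h2 (voltage_pow_eq_one ha (mul_mem (r₁_mem_mon _) (r₂_mem_mon _)) (g := g) (x := false)
      (y := true) (k := z * x) (fun h => ?_) (fun h => ?_) h1 (by simpa using hne)) <;>
    simp [basicTwo, mul_assoc]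

/-- Of the four boundary reflections, the one at the base flag gets trivial voltage and the others
`x, y, z`. As these are not 1, `r₁` fixes exactly the flags of the base fibre, which every
automorphism must preserve; the orders of products do not matter here. -/
theorem realisedOver_basicThree {G : Type u} [Group G] [Small.{0} G]
    (hG : GeneratedByAsymmetricInvolutions G) : basicThree.RealisedOver G := by
  suffices h : ∀ (H : Type) [Group H], GeneratedByAsymmetricInvolutions H →
      basicThree.RealisedOver H from
    (h (Shrink.{0} G) (hG.of_mulEquiv Shrink.mulEquiv.symm)).of_mulEquiv Shrink.mulEquiv.symm
  clear hG
  rintro H _ ⟨x, y, z, n, hx, hy, hz, hx', hy', hz', hcl, -, -⟩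
  let v : Bool × Bool → H := fun p => if p.1 then (if p.2 then z else x) else (if p.2 then y else 1)
  refine realisedOver_of_voltageMap (N := basicThree) (c₀ := 1) (c₂ := 1) (v := v)
    (h₀ := one_mul 1) (h₂ := one_mul 1) (h₀₂ := rfl) (hv := ?_) (false, false) ?_ _ hcl ?_ ?_
  · rintro ⟨_ | _, _ | _⟩ <;> simp [basicThree, v, hx, hy, hz]
  · decide
  · rintro s (rfl | rfl | rfl)
    · exact ⟨_, mul_mem (r₀_mem_mon _) (mul_mem (r₁_mem_mon _) (r₀_mem_mon _)),
        fun h => by simp [basicThree, v, flip₁]⟩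
    · exact ⟨_, mul_mem (r₂_mem_mon _) (mul_mem (r₁_mem_mon _) (r₂_mem_mon _)),
        fun h => by simp [basicThree, v, flip₂]⟩
    · exact ⟨_, mul_mem (r₀_mem_mon _) (mul_mem (r₂_mem_mon _) (mul_mem (r₁_mem_mon _)
        (mul_mem (r₂_mem_mon _) (r₀_mem_mon _)))),
        fun h => by simp [basicThree, v, flip₁, flip₂]⟩
  · intro a ha g
    have h := aut_apply_comm _ ha (r₁_mem_mon _) (g, (false, false))
    obtain ⟨⟨k, p, q⟩, hk⟩ : ∃ y, a (g, (false, false)) = y := ⟨_, rfl⟩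
    simp only [voltageMap_r₁, v, basicThree, Equiv.Perm.one_apply, Bool.false_eq_true, if_false,
      mul_one, hk, Prod.mk.injEq, and_true, left_eq_mul] at h
    rw [hk]
    cases p <;> cases q <;> simp_all

/-- The boundary flags carry `x` and `y`, the interior ones `z`. A single word in the `rᵢ` has
voltage `xz` at the base flag, but `yz` and `zy` at two of the other flags, so the exponent `n`
separates those fibres from the base. -/
theorem realisedOver_basicFour {G : Type u} [Group G] [Small.{0} G]
    (hG : GeneratedByAsymmetricInvolutions G) : basicFour.RealisedOver G := by
  suffices h : ∀ (H : Type) [Group H], GeneratedByAsymmetricInvolutions H →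
      basicFour.RealisedOver H from
    (h (Shrink.{0} G) (hG.of_mulEquiv Shrink.mulEquiv.symm)).of_mulEquiv Shrink.mulEquiv.symm
  clear hG
  rintro H _ ⟨x, y, z, n, hx, hy, hz, hx', hy', hz', hcl, h1, h2⟩
  let v : Bool × Bool → H := fun p => if p.1 then z else (if p.2 then y else x)
  have e1 : basicFour.r₁ (false, false) = (false, false) := by decide
  have e2 : basicFour.r₁ (false, true) = (false, true) := by decide
  have e3 : basicFour.r₁ (true, false) = (true, true) := by decide
  have e4 : basicFour.r₁ (true, true) = (true, false) := by decide
  have d1 : ∀ p, basicFour.r₀ p = (!p.1, p.2) := by decide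
  have d2 : ∀ p, basicFour.r₂ p = (p.1, !p.2) := by decide
  have h1' : (x * z) ^ n = 1 := (mul_pow_eq_one_comm z x n).mp h1
  have hv : ∀ p, v p * v (basicFour.r₁ p) = 1 := by
    rintro ⟨_ | _, _ | _⟩ <;> simp [e1, e2, e3, e4, v, hx, hy, hz]
  refine realisedOver_of_voltageMap (N := basicFour) (c₀ := 1) (c₂ := 1) (v := v)
    (h₀ := one_mul 1) (h₂ := one_mul 1) (h₀₂ := rfl) (hv := hv) (false, false) ?_ _ hcl ?_ ?_
  · decide
  · rintro s (rfl | rfl | rfl)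
    · exact ⟨_, r₁_mem_mon _, fun h => by simp [v, e1]⟩
    · exact ⟨_, mul_mem (r₂_mem_mon _) (mul_mem (r₁_mem_mon _) (r₂_mem_mon _)),
        fun h => by simp [v, e2, d2]⟩
    · exact ⟨_, mul_mem (r₀_mem_mon _) (mul_mem (r₂_mem_mon _) (mul_mem (r₁_mem_mon _)
        (r₀_mem_mon _))), fun h => by simp [v, d1, d2, e3]⟩
  · set M := voltageMap basicFour 1 1 v (one_mul 1) (one_mul 1) rfl hv
    have hW : M.r₀ * (M.r₂ * (M.r₁ * M.r₀)) * M.r₁ ∈ M.mon :=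
      mul_mem (mul_mem (r₀_mem_mon _) (mul_mem (r₂_mem_mon _) (mul_mem (r₁_mem_mon _)
        (r₀_mem_mon _)))) (r₁_mem_mon _)
    have hft : ∀ a ∈ M.aut, ∀ g, (a (g, (false, false))).2 ≠ (false, true) := by
      intro a ha g hg
      have := voltage_pow_eq_one ha hW (k := x * z) (l := y * z)
        (fun h => by simp [M, v, e1, d1, d2, e3, mul_assoc])
        (fun h => by simp [M, v, e2, d1, d2, e4, mul_assoc]) h1' hg
      exact h2 ((mul_pow_eq_one_comm y z n).mp this)
    have htf : ∀ a ∈ M.aut, ∀ g, (a (g, (false, false))).2 ≠ (true, false) := by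
      intro a ha g hg
      exact h2 (voltage_pow_eq_one ha hW (k := x * z) (l := z * y)
        (fun h => by simp [M, v, e1, d1, d2, e3, mul_assoc])
        (fun h => by simp [M, v, e3, d1, d2, e2, mul_assoc]) h1' hg)
    intro a ha g
    obtain ⟨⟨k, p⟩, hk⟩ : ∃ y, a (g, (false, false)) = y := ⟨_, rfl⟩
    have k1 := hft a ha g
    have k2 := htf a ha g
    have k3 := htf a ha (g * x)
    have h := aut_apply_comm _ ha (r₁_mem_mon _) (g, (false, false))
    rw [hk] at h k1 k2 ⊢
    rcases p with ⟨_ | _, _ | _⟩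
    · rfl
    · exact absurd rfl k1
    · exact absurd rfl k2
    -- The fibre of `(true, true)` reduces to that of `(true, false)` by applying `r₁`, which
    -- preserves the base fibre.
    · refine absurd ?_ k3
      have e : M.r₁ (g, (false, false)) = (g * x, (false, false)) := by simp [M, v, e1]
      rw [e] at h
      rw [h]
      simp [M, e4]

end EdgeTransitiveClass

end

/-! ### Groups generated by involutions -/

/-- Both `x` and `y` invert `xy`, so `⟨xy⟩` is normal. By simplicity it is trivial, whence `y = x`,
or everything; in either case the group is cyclic. -/
theorem forall_commute_of_closure_involutions {G : Type u} [Group G] [IsSimpleGroup G] {x y : G}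
    (hx : x * x = 1) (hy : y * y = 1) (h : Subgroup.closure {x, y} = ⊤) (a b : G) :
    a * b = b * a := by
  have ix : x⁻¹ = x := inv_eq_of_mul_eq_one_left hx
  have iy : y⁻¹ = y := inv_eq_of_mul_eq_one_left hy
  suffices hc : ∃ g : G, Subgroup.zpowers g = ⊤ by
    obtain ⟨g, hg⟩ := hc
    obtain ⟨m, rfl⟩ := Subgroup.mem_zpowers_iff.mp (hg ▸ Subgroup.mem_top a)
    obtain ⟨n, rfl⟩ := Subgroup.mem_zpowers_iff.mp (hg ▸ Subgroup.mem_top b)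
    exact (Commute.refl g).zpow_zpow m n
  have hconj : ∀ g ∈ Subgroup.closure {x, y}, ∀ n ∈ Subgroup.zpowers (x * y),
      g * n * g⁻¹ ∈ Subgroup.zpowers (x * y) := by
    intro g hg
    induction hg using Subgroup.closure_induction'' with
    | one => simp
    | mem g hg =>
      rintro _ ⟨k, rfl⟩
      refine ⟨-k, ?_⟩
      simp only
      rw [← conj_zpow, zpow_neg, ← inv_zpow]
      congr 1
      rcases hg with rfl | rfl
      · rw [mul_inv_rev, ix, iy, ← mul_assoc, hx, one_mul]
      · rw [mul_inv_rev, ix, iy, mul_assoc, mul_assoc, hy, mul_one]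
    | inv_mem g hg =>
      rintro _ ⟨k, rfl⟩
      refine ⟨-k, ?_⟩
      simp only
      rw [← conj_zpow, zpow_neg, ← inv_zpow]
      congr 1
      rcases hg with rfl | rfl
      · rw [inv_inv, mul_inv_rev, ix, iy, ← mul_assoc, hx, one_mul]
      · rw [inv_inv, mul_inv_rev, ix, iy, mul_assoc, mul_assoc, hy, mul_one]
    | mul g k _ _ hg hk =>
      intro n hn
      simpa only [mul_inv_rev, mul_assoc] using hg _ (hk n hn)
  have hn : (Subgroup.zpowers (x * y)).Normal :=
    ⟨fun n hn g => hconj g (h ▸ Subgroup.mem_top g) n hn⟩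
  rcases hn.eq_bot_or_eq_top with hb | ht
  · have hxy : x * y = 1 := Subgroup.zpowers_eq_bot.mp hb
    have : y = x := by rw [← ix]; exact (inv_eq_of_mul_eq_one_right hxy).symm
    refine ⟨x, ?_⟩
    rw [← h, this, Set.pair_eq_singleton, Subgroup.zpowers_eq_closure]
  · exact ⟨_, ht⟩

/-- Take `z = r₀`, `x = r₂`, `y = r₁` and exponent 2: `(r₀r₂)² = 1`, while `(r₀r₁)² = 1` would make
`r₀` central. None of the three is trivial, because two elements of order at most two cannot
generate. -/
theorem GeneratedByFlagReflections.asymmetric {G : Type u} [Group G] [IsSimpleGroup G]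
    (hnc : ¬ ∀ a b : G, a * b = b * a) (h : GeneratedByFlagReflections G) :
    GeneratedByAsymmetricInvolutions G := by
  obtain ⟨a, b, c, ha, hb, hc, hac, hcl⟩ := h
  have ha1 : a ≠ 1 := by
    rintro rfl
    rw [Subgroup.closure_insert_one] at hcl
    exact hnc (forall_commute_of_closure_involutions hb hc hcl)
  refine ⟨c, b, a, 2, hc, hb, ha, ?_, ?_, ha1, ?_, ?_, ?_⟩
  · rintro rfl
    rw [Set.pair_comm, Set.insert_comm, Subgroup.closure_insert_one] at hcl
    exact hnc (forall_commute_of_closure_involutions ha hb hcl)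
  · rintro rfl
    rw [Set.insert_comm, Subgroup.closure_insert_one] at hcl
    exact hnc (forall_commute_of_closure_involutions ha hc hcl)
  · rw [← hcl]
    congr 1
    ext x
    simp only [Set.mem_insert_iff, Set.mem_singleton_iff]
    tauto
  · rw [sq, mul_assoc, ← mul_assoc c, ← hac, mul_assoc a c, hc, mul_one, ha]
  · intro hab
    have hab' : a * b = b * a := by
      rw [sq, mul_eq_one_iff_eq_inv, mul_inv_rev, inv_eq_of_mul_eq_one_left ha,
        inv_eq_of_mul_eq_one_left hb] at hab
      exact hab
    have hz : a ∈ Subgroup.center G := by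
      rw [Subgroup.mem_center_iff]
      intro g
      have hg : g ∈ Subgroup.closure {a, b, c} := hcl ▸ Subgroup.mem_top g
      have : Subgroup.closure {a, b, c} ≤ Subgroup.centralizer {a} := by
        rw [Subgroup.closure_le]
        rintro x (rfl | rfl | rfl) <;>
          rw [SetLike.mem_coe, Subgroup.mem_centralizer_singleton_iff] <;> simp [hab', hac]
      exact Subgroup.mem_centralizer_singleton_iff.mp (this hg)
    rcases (inferInstance : (Subgroup.center G).Normal).eq_bot_or_eq_top with hb' | ht
    · rw [hb', Subgroup.mem_bot] at hz
      exact ha1 hz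
    · refine hnc fun x y => ?_
      have hy : y ∈ Subgroup.center G := ht ▸ Subgroup.mem_top y
      exact Subgroup.mem_center_iff.mp hy x

/-! ### Sections of the projection of a map to its quotient -/

namespace FlagMap

/-- A section `b` of the projection `f` from a map to its quotient by the automorphism group, with
the automorphisms measuring the failure of `b` to be equivariant. -/
structure AutSection {Φ : Type u} {X : Type v} (M : FlagMap Φ) (N : FlagMap X) (f : Φ → X) where
  b : X → Φ
  c₀ : X → M.aut
  c₁ : X → M.aut
  c₂ : X → M.aut
  f_b : ∀ x, f (b x) = x
  r₀_b : ∀ x, M.r₀ (b x) = (c₀ x).1 (b (N.r₀ x))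
  r₁_b : ∀ x, M.r₁ (b x) = (c₁ x).1 (b (N.r₁ x))
  r₂_b : ∀ x, M.r₂ (b x) = (c₂ x).1 (b (N.r₂ x))

namespace AutSection

variable {Φ : Type u} {X : Type v} {M : FlagMap Φ} {N : FlagMap X} {f : Φ → X}

theorem eq_of_apply_eq (s : AutSection M N f) (hM : M.Connected) (hf : M.IsAutQuotient N f)
    {a a' : M.aut} {x x' : X} (h : a.1 (s.b x) = a'.1 (s.b x')) : x = x' ∧ a = a' := by
  have e : ∀ (a : M.aut) y, f (a.1 y) = f y :=
    fun a y => ((hf.2.2.2.2 y _).mpr ⟨a.1, a.2, rfl⟩).symm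
  have hx : x = x' := by
    have := congrArg f h
    rwa [e, e, s.f_b, s.f_b] at this
  subst hx
  exact ⟨rfl, Subtype.ext (hM.aut_ext a.2 a'.2 h)⟩

/-- The flags `h (b x)` with `h ∈ H` are closed under the `rᵢ`, hence are all flags by
connectedness; freeness then puts every automorphism in `H`. -/
theorem closure_eq_top (s : AutSection M N f) (hM : M.Connected) (hf : M.IsAutQuotient N f)
    (x₀ : X) (H : Subgroup M.aut) (h₀ : ∀ x, s.c₀ x ∈ H) (h₁ : ∀ x, s.c₁ x ∈ H)
    (h₂ : ∀ x, s.c₂ x ∈ H) : H = ⊤ := by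
  rw [eq_top_iff]
  intro a _
  have key : ∃ h ∈ H, ∃ x, h.1 (s.b x) = a.1 (s.b x₀) := by
    refine hM.induction (fun y => ∃ h ∈ H, ∃ x, h.1 (s.b x) = y) ?_ ?_ ?_
      (x := s.b x₀) ⟨1, one_mem _, x₀, rfl⟩ _
    · rintro _ ⟨h, hh, x, rfl⟩
      exact ⟨h * s.c₀ x, mul_mem hh (h₀ x), N.r₀ x, by
        rw [← M.aut_apply_comm h.2 M.r₀_mem_mon, s.r₀_b]; rfl⟩
    · rintro _ ⟨h, hh, x, rfl⟩
      exact ⟨h * s.c₁ x, mul_mem hh (h₁ x), N.r₁ x, by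
        rw [← M.aut_apply_comm h.2 M.r₁_mem_mon, s.r₁_b]; rfl⟩
    · rintro _ ⟨h, hh, x, rfl⟩
      exact ⟨h * s.c₂ x, mul_mem hh (h₂ x), N.r₂ x, by
        rw [← M.aut_apply_comm h.2 M.r₂_mem_mon, s.r₂_b]; rfl⟩
  obtain ⟨h, hh, x, hx⟩ := key
  exact (s.eq_of_apply_eq hM hf hx).2 ▸ hh

/-- A symmetry of the quotient map which lifts must be trivial. -/
theorem symmetry_eq_one (s : AutSection M N f) (hM : M.Connected) (hf : M.IsAutQuotient N f)
    (α : M.aut ≃* M.aut) (t : X → X) (ht : ∀ x, t (t x) = x)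
    (t₀ : ∀ x, t (N.r₀ x) = N.r₀ (t x)) (t₁ : ∀ x, t (N.r₁ x) = N.r₁ (t x))
    (t₂ : ∀ x, t (N.r₂ x) = N.r₂ (t x)) (h₀ : ∀ x, α (s.c₀ x) = s.c₀ (t x))
    (h₁ : ∀ x, α (s.c₁ x) = s.c₁ (t x)) (h₂ : ∀ x, α (s.c₂ x) = s.c₂ (t x)) (x : X) :
    t x = x := by
  let e : M.aut × X → Φ := fun p => p.1.1 (s.b p.2)
  have he : Function.Bijective e := by
    constructor
    · rintro ⟨a, x⟩ ⟨a', x'⟩ h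
      obtain ⟨h1, h2⟩ := s.eq_of_apply_eq hM hf h
      exact Prod.ext h2 h1
    · intro y
      obtain ⟨a, ha, h⟩ := (hf.2.2.2.2 (s.b (f y)) y).mp (s.f_b _)
      exact ⟨(⟨a, ha⟩, f y), h⟩
  let E : M.aut × X ≃ Φ := Equiv.ofBijective e he
  let T : X ≃ X := ⟨t, t, ht, ht⟩
  -- The lift of `t`, sending `a (b x)` to `α a (b (t x))`. Compatibility with the voltages makes it
  -- an automorphism of `M`, and these act trivially on the quotient.
  let φ : Equiv.Perm Φ := E.symm.trans ((α.toEquiv.prodCongr T).trans E)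
  have hφ : ∀ (a : M.aut) x, φ (a.1 (s.b x)) = (α a).1 (s.b (t x)) := by
    intro a x
    have : E.symm (a.1 (s.b x)) = (a, x) := (Equiv.symm_apply_eq E).mpr rfl
    simp only [φ, Equiv.trans_apply, this]
    rfl
  have hmem : φ ∈ M.aut := by
    rw [mem_aut_iff]
    refine ⟨?_, ?_, ?_⟩ <;> intro y <;> obtain ⟨⟨a, x⟩, rfl⟩ := E.surjective y
    · change φ (M.r₀ (a.1 (s.b x))) = M.r₀ (φ (a.1 (s.b x)))
      have e1 : M.r₀ (a.1 (s.b x)) = (a * s.c₀ x).1 (s.b (N.r₀ x)) := by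
        rw [← M.aut_apply_comm a.2 M.r₀_mem_mon, s.r₀_b]; rfl
      rw [e1, hφ, hφ, ← M.aut_apply_comm (α a).2 M.r₀_mem_mon, s.r₀_b, map_mul, h₀, t₀]
      rfl
    · change φ (M.r₁ (a.1 (s.b x))) = M.r₁ (φ (a.1 (s.b x)))
      have e1 : M.r₁ (a.1 (s.b x)) = (a * s.c₁ x).1 (s.b (N.r₁ x)) := by
        rw [← M.aut_apply_comm a.2 M.r₁_mem_mon, s.r₁_b]; rfl
      rw [e1, hφ, hφ, ← M.aut_apply_comm (α a).2 M.r₁_mem_mon, s.r₁_b, map_mul, h₁, t₁]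
      rfl
    · change φ (M.r₂ (a.1 (s.b x))) = M.r₂ (φ (a.1 (s.b x)))
      have e1 : M.r₂ (a.1 (s.b x)) = (a * s.c₂ x).1 (s.b (N.r₂ x)) := by
        rw [← M.aut_apply_comm a.2 M.r₂_mem_mon, s.r₂_b]; rfl
      rw [e1, hφ, hφ, ← M.aut_apply_comm (α a).2 M.r₂_mem_mon, s.r₂_b, map_mul, h₂, t₂]
      rfl
  have h1 := hφ 1 x
  rw [map_one] at h1
  have h2 : (⟨φ, hmem⟩ : M.aut).1 (s.b x) = (1 : M.aut).1 (s.b (t x)) := h1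
  exact (s.eq_of_apply_eq hM hf h2).1.symm

end AutSection

end FlagMap

/-! ### What a realisation forces on the group: classes 1, 2 ex and 5 -/

section

open FlagMap

namespace EdgeTransitiveClass

/-- With a one-flag quotient `Aut M` is simply transitive on flags. The automorphisms matching `rᵢ`
at `x₀` multiply in the opposite order to the `rᵢ`, which does not affect the relations required. -/
theorem generatedByFlagReflections_of_realisedOver {G : Type u} [Group G]
    (h : (basicMap .one).RealisedOver G) : GeneratedByFlagReflections G := by
  obtain ⟨Φ, M, hM, -, ⟨f, hf⟩, ⟨e⟩⟩ := h
  apply GeneratedByFlagReflections.of_mulEquiv e.symm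
  obtain ⟨x₀⟩ := hM.1
  obtain ⟨a, ha, ha'⟩ := (hf.2.2.2.2 x₀ (M.r₀ x₀)).mp rfl
  obtain ⟨b, hb, hb'⟩ := (hf.2.2.2.2 x₀ (M.r₁ x₀)).mp rfl
  obtain ⟨c, hc, hc'⟩ := (hf.2.2.2.2 x₀ (M.r₂ x₀)).mp rfl
  refine ⟨⟨a, ha⟩, ⟨b, hb⟩, ⟨c, hc⟩, ?_, ?_, ?_, ?_, ?_⟩
  · refine Subtype.ext (hM.aut_ext (mul_mem ha ha) (one_mem _) (x := x₀) ?_)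
    simp [ha', M.aut_apply_comm ha M.r₀_mem_mon, r₀_r₀]
  · refine Subtype.ext (hM.aut_ext (mul_mem hb hb) (one_mem _) (x := x₀) ?_)
    simp [hb', M.aut_apply_comm hb M.r₁_mem_mon, r₁_r₁]
  · refine Subtype.ext (hM.aut_ext (mul_mem hc hc) (one_mem _) (x := x₀) ?_)
    simp [hc', M.aut_apply_comm hc M.r₂_mem_mon, r₂_r₂]
  · refine Subtype.ext (hM.aut_ext (mul_mem ha hc) (mul_mem hc ha) (x := x₀) ?_)
    simp [ha', hc', M.aut_apply_comm ha M.r₂_mem_mon, M.aut_apply_comm hc M.r₀_mem_mon, r₂_r₀]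
  · let s : AutSection M (basicMap .one) f :=
      { b := fun _ => x₀
        c₀ := fun _ => ⟨a, ha⟩
        c₁ := fun _ => ⟨b, hb⟩
        c₂ := fun _ => ⟨c, hc⟩
        f_b := fun _ => rfl
        r₀_b := fun _ => ha'.symm
        r₁_b := fun _ => hb'.symm
        r₂_b := fun _ => hc'.symm }
    exact s.closure_eq_top hM hf () _ (fun _ => Subgroup.subset_closure (by simp [s]))
      (fun _ => Subgroup.subset_closure (by simp [s]))
      (fun _ => Subgroup.subset_closure (by simp [s]))

/-- Any two generators of `G` are inverted by an automorphism. -/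
def _root_.GeneratingPairsInvertible (G : Type u) [Group G] : Prop :=
  ∀ a b : G, Subgroup.closure {a, b} = ⊤ → ∃ α : G ≃* G, α a = a⁻¹ ∧ α b = b⁻¹

theorem _root_.GeneratingPairsInvertible.of_mulEquiv {G : Type u} [Group G] {H : Type v} [Group H]
    (e : G ≃* H) (h : GeneratingPairsInvertible G) : GeneratingPairsInvertible H := by
  intro a b hab
  obtain ⟨α, ha, hb⟩ := h (e.symm a) (e.symm b) (by
    have := congrArg (Subgroup.map e.symm.toMonoidHom) hab
    rw [MonoidHom.map_closure, Subgroup.map_top_of_surjective _ e.symm.surjective] at this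
    simpa [Set.image_insert_eq] using this)
  exact ⟨e.symm.trans (α.trans e), by simp [ha], by simp [hb]⟩

/-- `Aut M` is generated by `z` with `z² = 1` and by `w`, and the flip of the two flags below
interchanges the voltages `w` and `w⁻¹`. An automorphism inverting `z` and `w` therefore lifts the
flip. -/
theorem not_realisedOver_basicTwoEx {G : Type u} [Group G] (hG : GeneratingPairsInvertible G) :
    ¬ basicTwoEx.RealisedOver G := by
  rintro ⟨Φ, M, hM, -, ⟨f, hf⟩, ⟨e⟩⟩
  replace hG := hG.of_mulEquiv e
  obtain ⟨hfs, f₀, f₁, f₂, hfa⟩ := id hf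
  obtain ⟨x₀, hx₀⟩ := hfs false
  obtain ⟨z, hz, hz'⟩ := (hfa x₀ (M.r₂ x₀)).mp (by rw [f₂]; rfl)
  obtain ⟨w, hw, hw'⟩ := (hfa (M.r₀ x₀) (M.r₁ x₀)).mp (by rw [f₀, f₁]; rfl)
  have n₀ : ∀ x, basicTwoEx.r₀ x = !x := by decide
  have n₁ : ∀ x, basicTwoEx.r₁ x = !x := by decide
  have n₂ : ∀ x, basicTwoEx.r₂ x = x := by decide
  have hw2 : M.r₁ (M.r₀ x₀) = (⟨w, hw⟩⁻¹ : M.aut).1 x₀ := by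
    change _ = w⁻¹ x₀
    rw [Equiv.Perm.eq_inv_iff_eq, M.aut_apply_comm hw M.r₁_mem_mon, hw', r₁_r₁]
  have hzz : (⟨z, hz⟩ : M.aut)⁻¹ = ⟨z, hz⟩ := by
    refine inv_eq_of_mul_eq_one_left (Subtype.ext ?_)
    refine hM.aut_ext (mul_mem hz hz) (one_mem _) (x := x₀) ?_
    simp [hz', M.aut_apply_comm hz M.r₂_mem_mon, r₂_r₂]
  let s : AutSection M basicTwoEx f :=
    { b := fun p => if p then M.r₀ x₀ else x₀
      c₀ := fun _ => 1
      c₁ := fun p => if p then ⟨w, hw⟩⁻¹ else ⟨w, hw⟩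
      c₂ := fun _ => ⟨z, hz⟩
      f_b := by rintro (_ | _) <;> simp [hx₀, f₀, n₀]
      r₀_b := by rintro (_ | _) <;> simp [n₀, r₀_r₀]
      r₁_b := by
        rintro (_ | _)
        · simp [n₁, hw']
        · simpa [n₁] using hw2
      r₂_b := by
        rintro (_ | _)
        · simp [n₂, hz']
        · simp [n₂, hz', M.aut_apply_comm hz M.r₀_mem_mon, r₂_r₀] }
  have hgen : Subgroup.closure {(⟨z, hz⟩ : M.aut), ⟨w, hw⟩} = ⊤ := by
    have mw : (⟨w, hw⟩ : M.aut) ∈ Subgroup.closure {(⟨z, hz⟩ : M.aut), ⟨w, hw⟩} :=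
      Subgroup.subset_closure (by simp)
    refine s.closure_eq_top hM hf false _ (fun _ => one_mem _) ?_
      (fun _ => Subgroup.subset_closure (by simp [s]))
    rintro (_ | _)
    · exact mw
    · exact inv_mem mw
  obtain ⟨α, hα, hα'⟩ := hG _ _ hgen
  have := s.symmetry_eq_one hM hf α (fun x => !x) (by decide) (by decide) (by decide) (by decide)
    (fun _ => map_one α) (by
      rintro (_ | _)
      · exact hα'
      · change α (⟨w, hw⟩⁻¹) = ⟨w, hw⟩
        rw [map_inv, hα', inv_inv]) (fun _ => hα.trans hzz) false
  exact absurd this (by decide)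

/-- `v` and `w` are the rotations about the two ends of the edge. The reflection of the sphere
fixing both ends inverts these voltages, so an automorphism inverting `v` and `w` lifts it. -/
theorem not_realisedOver_basicFive {G : Type u} [Group G] (hG : GeneratingPairsInvertible G) :
    ¬ basicFive.RealisedOver G := by
  rintro ⟨Φ, M, hM, -, ⟨f, hf⟩, ⟨e⟩⟩
  replace hG := hG.of_mulEquiv e
  obtain ⟨hfs, f₀, f₁, f₂, hfa⟩ := id hf
  obtain ⟨x₀, hx₀⟩ := hfs (false, false)
  obtain ⟨v, hv, hv'⟩ := (hfa (M.r₂ x₀) (M.r₁ x₀)).mp (by rw [f₂, f₁]; rfl)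
  obtain ⟨w, hw, hw'⟩ := (hfa (M.r₀ (M.r₂ x₀)) (M.r₁ (M.r₀ x₀))).mp (by
    rw [f₀, f₂, f₁, f₀, hx₀]; rfl)
  have n₀ : ∀ x, basicFive.r₀ x = (!x.1, x.2) := by decide
  have n₁ : ∀ x, basicFive.r₁ x = (x.1, !x.2) := by decide
  have n₂ : ∀ x, basicFive.r₂ x = (x.1, !x.2) := by decide
  have hv2 : M.r₁ (M.r₂ x₀) = (⟨v, hv⟩⁻¹ : M.aut).1 x₀ := by
    change _ = v⁻¹ x₀
    rw [Equiv.Perm.eq_inv_iff_eq, M.aut_apply_comm hv M.r₁_mem_mon, hv', r₁_r₁]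
  have hw2 : M.r₁ (M.r₀ (M.r₂ x₀)) = (⟨w, hw⟩⁻¹ : M.aut).1 (M.r₀ x₀) := by
    change _ = w⁻¹ (M.r₀ x₀)
    rw [Equiv.Perm.eq_inv_iff_eq, M.aut_apply_comm hw M.r₁_mem_mon, hw', r₁_r₁]
  let s : AutSection M basicFive f :=
    { b := fun p => if p.1 then (if p.2 then M.r₀ (M.r₂ x₀) else M.r₀ x₀)
        else (if p.2 then M.r₂ x₀ else x₀)
      c₀ := fun _ => 1
      c₁ := fun p => if p.1 then (if p.2 then ⟨w, hw⟩⁻¹ else ⟨w, hw⟩)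
        else (if p.2 then ⟨v, hv⟩⁻¹ else ⟨v, hv⟩)
      c₂ := fun _ => 1
      f_b := by rintro ⟨_ | _, _ | _⟩ <;> simp [hx₀, f₀, f₂, n₀, n₂]
      r₀_b := by rintro ⟨_ | _, _ | _⟩ <;> simp [n₀, r₀_r₀]
      r₁_b := by
        rintro ⟨_ | _, _ | _⟩
        · simp [n₁, hv']
        · simpa [n₁] using hv2
        · simp [n₁, hw']
        · simpa [n₁] using hw2
      r₂_b := by rintro ⟨_ | _, _ | _⟩ <;> simp [n₂, r₂_r₂, r₂_r₀] }
  have hgen : Subgroup.closure {(⟨v, hv⟩ : M.aut), ⟨w, hw⟩} = ⊤ := by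
    have mv : (⟨v, hv⟩ : M.aut) ∈ Subgroup.closure {(⟨v, hv⟩ : M.aut), ⟨w, hw⟩} :=
      Subgroup.subset_closure (by simp)
    have mw : (⟨w, hw⟩ : M.aut) ∈ Subgroup.closure {(⟨v, hv⟩ : M.aut), ⟨w, hw⟩} :=
      Subgroup.subset_closure (by simp)
    refine s.closure_eq_top hM hf (false, false) _ (fun _ => one_mem _) ?_ (fun _ => one_mem _)
    rintro ⟨_ | _, _ | _⟩
    · exact mv
    · exact inv_mem mv
    · exact mw
    · exact inv_mem mw
  obtain ⟨α, hα, hα'⟩ := hG _ _ hgen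
  have := s.symmetry_eq_one hM hf α (fun x => (x.1, !x.2)) (by decide) (by decide) (by decide)
    (by decide) (fun _ => map_one α) (by
      rintro ⟨_ | _, _ | _⟩
      · exact hα
      · change α (⟨v, hv⟩⁻¹) = ⟨v, hv⟩
        rw [map_inv, hα, inv_inv]
      · exact hα'
      · change α (⟨w, hw⟩⁻¹) = ⟨w, hw⟩
        rw [map_inv, hα', inv_inv]) (fun _ => map_one α) (false, false)
  exact absurd this (by decide)

end EdgeTransitiveClass

end

/-! ### Generation of `SL₂` over a finite field -/

namespace SL2

open Matrix

section CommRing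

variable {F : Type u} [CommRing F]

/-- The matrix with rows `(a, b)` and `(c, d)` has determinant one and lies in `H`. -/
def Mem (H : Subgroup (SpecialLinearGroup (Fin 2) F)) (a b c d : F) : Prop :=
  ∃ M ∈ H, (M : Matrix (Fin 2) (Fin 2) F) = !![a, b; c, d]

variable {H : Subgroup (SpecialLinearGroup (Fin 2) F)} {a b c d a' b' c' d' : F}

theorem Mem.det (h : Mem H a b c d) : a * d - b * c = 1 := by
  obtain ⟨M, -, hM⟩ := h
  have := M.2
  rwa [hM, det_fin_two_of] at this

theorem Mem.mul (h : Mem H a b c d) (h' : Mem H a' b' c' d') :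
    Mem H (a * a' + b * c') (a * b' + b * d') (c * a' + d * c') (c * b' + d * d') := by
  obtain ⟨M, hM, e⟩ := h
  obtain ⟨M', hM', e'⟩ := h'
  refine ⟨M * M', mul_mem hM hM', (Matrix.SpecialLinearGroup.coe_mul M M').trans ?_⟩
  rw [e, e', mul_fin_two]

theorem Mem.inv (h : Mem H a b c d) : Mem H d (-b) (-c) a := by
  obtain ⟨M, hM, e⟩ := h
  refine ⟨M⁻¹, inv_mem hM, (Matrix.SpecialLinearGroup.coe_inv M).trans ?_⟩
  rw [e, adjugate_fin_two_of]

theorem Mem.congr (h : Mem H a b c d) (ha : a = a') (hb : b = b') (hc : c = c') (hd : d = d') :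
    Mem H a' b' c' d' := by
  subst ha hb hc hd
  exact h

theorem Mem.one : Mem H (1 : F) 0 0 1 := ⟨1, one_mem H, by simp [one_fin_two]⟩

theorem eq_top_iff_mem : H = ⊤ ↔ ∀ a b c d : F, a * d - b * c = 1 → Mem H a b c d := by
  constructor
  · rintro rfl a b c d h
    exact ⟨⟨!![a, b; c, d], by rw [det_fin_two_of, h]⟩, Subgroup.mem_top _, rfl⟩
  · intro h
    rw [eq_top_iff]
    rintro M -
    obtain ⟨N, hN, e⟩ := h (M 0 0) (M 0 1) (M 1 0) (M 1 1) (by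
      have := M.2; rwa [det_fin_two] at this)
    have : N = M := Subtype.ext (e.trans (eta_fin_two _).symm)
    exact this ▸ hN

theorem Mem.unipotent_add {s t : F} (hs : Mem H 1 s 0 1) (ht : Mem H 1 t 0 1) :
    Mem H 1 (s + t) 0 1 :=
  (hs.mul ht).congr (by ring) (by ring) (by ring) (by ring)

/-- The additive group of the upper unipotent elements of `H`. -/
def unipotents (H : Subgroup (SpecialLinearGroup (Fin 2) F)) : AddSubgroup F where
  carrier := {t | Mem H 1 t 0 1}
  zero_mem' := Mem.one
  add_mem' := Mem.unipotent_add
  neg_mem' := fun h => h.inv.congr rfl rfl neg_zero rfl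

theorem mem_unipotents {t : F} : t ∈ unipotents H ↔ Mem H 1 t 0 1 := Iff.rfl

/-- The square of `± u_t` is `u_{2t}`. -/
theorem Mem.two_mul_mem_unipotents {p t : F} (hp : p * p = 1) (h : Mem H p t 0 p) :
    2 * (p * t) ∈ unipotents H :=
  (h.mul h).congr (by rw [hp]; ring) (by ring) (by ring) (by rw [hp]; ring)

end CommRing

section Field

variable {F : Type u} [Field F] {H : Subgroup (SpecialLinearGroup (Fin 2) F)} {a b c d : F}

/-- Multiplying by upper unipotents on both sides clears the diagonal and leaves a Weyl element,
which conjugates the upper unipotents to the lower ones. Matrices with `c ≠ 0` then factor as upper,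
lower, upper, and a row operation reduces `c = 0` to this. -/
theorem eq_top_of_unipotents (hu : unipotents H = ⊤) (h : Mem H a b c d) (hc : c ≠ 0) :
    H = ⊤ := by
  have U : ∀ t : F, Mem H 1 t 0 1 := fun t =>
    mem_unipotents.mp (hu ▸ AddSubgroup.mem_top t)
  have hW : Mem H 0 (-c⁻¹) c 0 := by
    have hdet := h.det
    refine (((U (-(a / c))).mul h).mul (U (-(d / c)))).congr ?_ ?_ ?_ ?_
    · field_simp; ring
    · field_simp
      linear_combination -hdet
    · ring
    · field_simp; ring
  have L : ∀ t : F, Mem H 1 0 t 1 := fun t =>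
    ((hW.mul (U (-(t / (c * c))))).mul hW.inv).congr (by field_simp; ring) (by ring)
      (by field_simp; ring) (by field_simp; ring)
  have big : ∀ a b c d : F, a * d - b * c = 1 → c ≠ 0 → Mem H a b c d := by
    intro a b c d hdet hc
    refine (((U ((a - 1) / c)).mul (L c)).mul (U ((d - 1) / c))).congr ?_ ?_ ?_ ?_
    · field_simp; ring
    · field_simp
      linear_combination hdet
    · ring
    · field_simp; ring
  rw [eq_top_iff_mem]
  intro a b c d hdet
  by_cases hc : c = 0
  · subst hc
    have ha : a ≠ 0 := by
      rintro rfl; simp at hdet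
    exact ((L (-1)).mul (big a b (a + 0) (b + d) (by linear_combination hdet) (by simpa using ha))).congr
      (by ring) (by ring) (by ring) (by ring)
  · exact big a b c d hdet hc

/-- Two elements of `H` with the same lower rows, up to the action of the torus. -/
theorem exists_upper_of_rows {a' b' c' d' m : F} (hD : ∀ l : F, l ≠ 0 → Mem H l 0 0 l⁻¹)
    (h : Mem H a b c d) (h' : Mem H a' b' c' d') (hm : m ≠ 0)
    (hr : c * d' = m * m * c' * d) (hne : a * d ≠ a' * d') :
    ∃ p t q : F, t ≠ 0 ∧ Mem H p t 0 q := by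
  refine ⟨_, _, _, ?_, (h.mul (h'.mul (hD m hm)).inv).congr rfl rfl ?_ rfl⟩
  -- If the product were diagonal, the two matrices would differ by diagonal factors of determinant
  -- one on both sides, which preserve the product of the diagonal entries.
  · intro h0
    have d1 := h.det
    have d2 := h'.det
    apply hne
    have e1 : b * a' * (m * m) = a * b' := by
      field_simp at h0
      linear_combination h0
    have e2 : (b * c) * (a' * d') = (a * d) * (b' * c') := by
      have : (m * m) * ((b * c) * (a' * d') - (a * d) * (b' * c')) = 0 := by
        linear_combination c * d' * e1 + a * b' * hr
      have h3 := (mul_eq_zero.mp this).resolve_left (mul_ne_zero hm hm)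
      linear_combination h3
    linear_combination e2 + (a' * d') * d1 - (a * d) * d2
  · field_simp
    linear_combination hr

/-- Torus conjugation multiplies a unipotent parameter by squares, and every element of a finite
field is a sum of two squares. -/
theorem unipotents_eq_top_of_upper [Finite F] (hD : ∀ l : F, l ≠ 0 → Mem H l 0 0 l⁻¹) {p t q : F}
    (ht : t ≠ 0) (h : Mem H p t 0 q) : unipotents H = ⊤ := by
  have hdet := h.det
  have hp : p ≠ 0 := by rintro rfl; simp at hdet
  have hq : q = p⁻¹ := by field_simp; linear_combination hdet
  have h1 : Mem H 1 (t * p) 0 1 := by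
    refine (h.mul (hD p⁻¹ (inv_ne_zero hp))).congr ?_ ?_ ?_ ?_
    · field_simp; ring
    · field_simp; ring
    · ring
    · rw [hq]; field_simp; ring
  have hsq : ∀ l : F, t * p * (l * l) ∈ unipotents H := by
    intro l
    by_cases hl : l = 0
    · subst hl; simp
    · rw [mem_unipotents]
      refine (((hD l hl).mul h1).mul (hD l⁻¹ (inv_ne_zero hl))).congr ?_ ?_ ?_ ?_
      · field_simp; ring
      · field_simp; ring
      · ring
      · field_simp; ring
  rw [eq_top_iff]
  rintro x -
  have key : ∀ y : F, ∃ l m : F, y = l * l + m * m := by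
    intro y
    have := Fintype.ofFinite F
    by_cases h2 : ringChar F = 2
    · obtain ⟨l, hl⟩ := FiniteField.isSquare_of_char_two h2 y
      exact ⟨l, 0, by rw [hl]; ring⟩
    · have hodd : Fintype.card F % 2 = 1 := FiniteField.odd_card_of_char_ne_two h2
      obtain ⟨l, m, hlm⟩ := FiniteField.exists_root_sum_quadratic (R := F)
        (f := Polynomial.X ^ 2) (g := Polynomial.X ^ 2 - Polynomial.C y)
        (Polynomial.degree_X_pow 2) (Polynomial.degree_X_pow_sub_C (by decide) _) hodd
      refine ⟨l, m, ?_⟩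
      simp only [Polynomial.eval_pow, Polynomial.eval_X, Polynomial.eval_sub,
        Polynomial.eval_C] at hlm
      linear_combination -hlm
  obtain ⟨l, m, hlm⟩ := key (x / (t * p))
  have : x = t * p * (l * l) + t * p * (m * m) := by
    rw [← mul_add, ← hlm]; field_simp
  rw [this]
  exact add_mem (hsq l) (hsq m)

/-- A criterion for generation, comparing `M diag(l, l⁻¹) M⁻¹` with `M diag(m, m⁻¹) M⁻¹`. -/
theorem eq_top_of_torus_pair [Finite F] (hD : ∀ l : F, l ≠ 0 → Mem H l 0 0 l⁻¹)
    (h : Mem H a b c d) (ha : a ≠ 0) (hb : b ≠ 0) (hc : c ≠ 0) (hd : d ≠ 0) {l m n : F}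
    (hl : l ≠ 0) (hm : m ≠ 0) (hn : n ≠ 0)
    (hlm : l * l ≠ m * m) (hlm' : (l * l) * (m * m) ≠ 1)
    (hr : (l * l - 1) * (a * d - b * c * (m * m)) =
      n * n * ((m * m - 1) * (a * d - b * c * (l * l)))) : H = ⊤ := by
  have X : ∀ l : F, l ≠ 0 → Mem H (a * d * l - b * c * l⁻¹) (a * b * (l⁻¹ - l))
      (c * d * (l - l⁻¹)) (a * d * l⁻¹ - b * c * l) := fun l hl =>
    ((h.mul (hD l hl)).mul h.inv).congr (by ring) (by ring) (by ring) (by ring)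
  have hli : l - l⁻¹ = (l * l - 1) / l := by field_simp
  have hdi : a * d * l⁻¹ - b * c * l = (a * d - b * c * (l * l)) / l := by field_simp
  have hmi : m - m⁻¹ = (m * m - 1) / m := by field_simp
  have hdm : a * d * m⁻¹ - b * c * m = (a * d - b * c * (m * m)) / m := by field_simp
  obtain ⟨p, t, q, ht, hu⟩ := exists_upper_of_rows hD (X l hl) (X m hm) hn
    (by
      rw [hli, hdi, hmi, hdm]
      field_simp
      linear_combination hr)
    (by
      intro e
      have e1 : (a * d * (b * c)) * ((l * l - m * m) * (l * l * (m * m) - 1)) = 0 := by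
        field_simp at e
        linear_combination -e
      have hne : (a * d * (b * c)) * ((l * l - m * m) * (l * l * (m * m) - 1)) ≠ 0 :=
        mul_ne_zero (mul_ne_zero (mul_ne_zero ha hd) (mul_ne_zero hb hc))
          (mul_ne_zero (sub_ne_zero.mpr hlm) (sub_ne_zero.mpr hlm'))
      exact hne e1)
  exact eq_top_of_unipotents (unipotents_eq_top_of_upper hD ht hu) h hc

end Field

section

variable {F : Type u} [Field F] {H : Subgroup (SpecialLinearGroup (Fin 2) F)} {a b c d : F}

theorem exists_generator (F : Type u) [Field F] [Finite F] :
    ∃ ν : F, ν ≠ 0 ∧ (∀ x : F, x ≠ 0 → ∃ k : ℕ, x = ν ^ k) ∧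
      ∀ k : ℕ, ν ^ k = 1 ↔ Nat.card F - 1 ∣ k := by
  obtain ⟨g, hg⟩ := IsCyclic.exists_generator (α := Fˣ)
  refine ⟨g, g.ne_zero, fun x hx => ?_, fun k => ?_⟩
  · obtain ⟨k, hk⟩ := mem_powers_iff_mem_zpowers.mpr (hg (Units.mk0 x hx))
    exact ⟨k, by simpa using congrArg Units.val hk.symm⟩
  · rw [← Nat.card_units, ← orderOf_eq_card_of_forall_mem_zpowers hg, orderOf_dvd_iff_pow_eq_one,
      Units.ext_iff]
    simp

/-- A subgroup containing the split torus, and a matrix without zero entries, is everything. -/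
theorem eq_top_of_torus [Finite F] (hF : 16 ≤ Nat.card F ∨ Nat.card F = 8)
    (hD : ∀ l : F, l ≠ 0 → Mem H l 0 0 l⁻¹)
    (h : Mem H a b c d) (ha : a ≠ 0) (hb : b ≠ 0) (hc : c ≠ 0) (hd : d ≠ 0) : H = ⊤ := by
  obtain ⟨ν, hν, hgen, hord⟩ := exists_generator F
  -- The ratio of the lower row entries of `M diag(l, l⁻¹) M⁻¹`, `l = ν ^ k`, up to the constant `c
  -- * d`. The torus on the right multiplies it by squares, so only its square class matters; `good`
  -- says that the denominator is not zero.
  let R : ℕ → F := fun k => (ν ^ k * ν ^ k - 1) / (a * d - b * c * (ν ^ k * ν ^ k))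
  let good : ℕ → Prop := fun k => a * d - b * c * (ν ^ k * ν ^ k) ≠ 0
  have e2 : ∀ k, ν ^ k * ν ^ k = ν ^ (2 * k) := fun k => by ring
  -- For `l = ν ^ j` and `m = ν ^ k` the two non-divisibility conditions say `l² ≠ m²` and `l²m² ≠
  -- 1`.
  have pair : ∀ j k, j < k → ¬ (Nat.card F - 1 ∣ 2 * (k - j)) → ¬ (Nat.card F - 1 ∣ 2 * (j + k)) →
      good j → good k → (∃ n, n ≠ 0 ∧ R j = n * n * R k) → H = ⊤ := by
    intro j k hjk hd1 hd2 hj hk ⟨n, hn, hR⟩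
    refine eq_top_of_torus_pair hD h ha hb hc hd (pow_ne_zero j hν) (pow_ne_zero k hν) hn ?_ ?_ ?_
    · intro heq
      apply hd1
      rw [← hord]
      have : ν ^ (2 * j) * ν ^ (2 * (k - j)) = ν ^ (2 * j) * 1 := by
        rw [← pow_add, mul_one, ← e2 j, heq, e2]
        congr 1
        omega
      exact mul_left_cancel₀ (pow_ne_zero _ hν) this
    · intro heq
      apply hd2
      rw [← hord, ← heq]
      ring
    · simp only [R] at hR
      rw [div_eq_iff hj] at hR
      have hk' : a * d - b * c * (ν ^ k * ν ^ k) ≠ 0 := hk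
      linear_combination (a * d - b * c * (ν ^ k * ν ^ k)) * hR +
        n * n * (a * d - b * c * (ν ^ j * ν ^ j)) * div_mul_cancel₀ (ν ^ k * ν ^ k - 1) hk'
  have bad : ∀ j k, j < k → ¬ (Nat.card F - 1 ∣ 2 * (k - j)) → ¬ good j → good k := by
    intro j k hjk hd1 hj hk
    apply hd1
    rw [← hord]
    have h1 : a * d - b * c * (ν ^ j * ν ^ j) = 0 := not_not.mp hj
    have h2 : b * c * (ν ^ j * ν ^ j) = b * c * (ν ^ k * ν ^ k) := by
      linear_combination hk - h1
    have h3 := mul_left_cancel₀ (mul_ne_zero hb hc) h2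
    have : ν ^ (2 * j) * ν ^ (2 * (k - j)) = ν ^ (2 * j) * 1 := by
      rw [← pow_add, mul_one, ← e2 j, h3, e2]
      congr 1
      omega
    exact mul_left_cancel₀ (pow_ne_zero _ hν) this
  have hR0 : ∀ k, ¬ (Nat.card F - 1 ∣ 2 * k) → good k → R k ≠ 0 := by
    intro k hk hg
    refine div_ne_zero (sub_ne_zero.mpr ?_) hg
    rwa [e2, Ne, hord]
  rcases hF with hF | hF
  -- The exponents used go up to `2 * (3 + 4) = 14`, whence the bound 16 on the field.
  · have nd : ∀ m, 0 < m → m < 15 → ¬ (Nat.card F - 1 ∣ m) := fun m h0 h1 h2 => by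
      have := Nat.le_of_dvd h0 h2
      omega
    -- There are at most two square classes, so two of three ratios agree. At most one of the
    -- exponents 1, 2, 3, 4 is not good, so three remain.
    have triple : ∀ i j k, 0 < i → i < j → j < k → k ≤ 4 → good i → good j → good k → H = ⊤ := by
      intro i j k h0 hij hjk hk gi gj gk
      obtain ⟨x, hx⟩ := hgen _ (hR0 i (nd _ (by omega) (by omega)) gi)
      obtain ⟨y, hy⟩ := hgen _ (hR0 j (nd _ (by omega) (by omega)) gj)
      obtain ⟨z, hz⟩ := hgen _ (hR0 k (nd _ (by omega) (by omega)) gk)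
      have par : ∀ x y : ℕ, x % 2 = y % 2 → ∃ n : F, n ≠ 0 ∧ ν ^ x = n * n * ν ^ y := by
        intro x y hxy
        have he : Even ((x : ℤ) - y) := by
          rw [Int.even_sub]
          simp only [Int.even_coe_nat, Nat.even_iff]
          omega
        obtain ⟨m, hm⟩ := he
        refine ⟨ν ^ m, zpow_ne_zero _ hν, ?_⟩
        rw [← zpow_natCast, ← zpow_natCast, ← zpow_add₀ hν, ← zpow_add₀ hν]
        congr 1
        omega
      have : x % 2 = y % 2 ∨ y % 2 = z % 2 ∨ x % 2 = z % 2 := by omega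
      rcases this with hp | hp | hp
      · exact pair i j hij (nd _ (by omega) (by omega)) (nd _ (by omega) (by omega)) gi gj
          (by rw [hx, hy]; exact par _ _ hp)
      · exact pair j k hjk (nd _ (by omega) (by omega)) (nd _ (by omega) (by omega)) gj gk
          (by rw [hy, hz]; exact par _ _ hp)
      · exact pair i k (hij.trans hjk) (nd _ (by omega) (by omega)) (nd _ (by omega) (by omega))
          gi gk (by rw [hx, hz]; exact par _ _ hp)
    have bad' : ∀ j k, j < k → k ≤ 4 → ¬ good j → good k := fun j k hjk hk =>
      bad j k hjk (nd _ (by omega) (by omega))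
    by_cases g1 : good 1
    · by_cases g2 : good 2
      · by_cases g3 : good 3
        · exact triple 1 2 3 (by omega) (by omega) (by omega) (by omega) g1 g2 g3
        · exact triple 1 2 4 (by omega) (by omega) (by omega) (by omega) g1 g2
            (bad' 3 4 (by omega) (by omega) g3)
      · exact triple 1 3 4 (by omega) (by omega) (by omega) (by omega) g1
          (bad' 2 3 (by omega) (by omega) g2) (bad' 2 4 (by omega) (by omega) g2)
    · exact triple 2 3 4 (by omega) (by omega) (by omega) (by omega)
          (bad' 1 2 (by omega) (by omega) g1) (bad' 1 3 (by omega) (by omega) g1)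
          (bad' 1 4 (by omega) (by omega) g1)
  · have h7 : Nat.card F - 1 = 7 := by omega
    rw [h7] at pair bad hR0 hord
    -- The multiplicative group has odd order 7, so everything is a square: `u = (u ^ 4) ^ 2`. Two
    -- good exponents now suffice.
    have sqr : ∀ j k, ¬ (7 ∣ 2 * j) → ¬ (7 ∣ 2 * k) → good j → good k →
        ∃ n, n ≠ 0 ∧ R j = n * n * R k := by
      intro j k hj hk gj gk
      have r1 := hR0 j hj gj
      have r2 := hR0 k hk gk
      obtain ⟨m, hm⟩ := hgen _ (div_ne_zero r1 r2)
      refine ⟨(R j / R k) ^ 4, pow_ne_zero _ (div_ne_zero r1 r2), ?_⟩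
      have h8 : (R j / R k) ^ 7 = 1 := by
        rw [hm, ← pow_mul, hord]
        exact Dvd.intro_left m rfl
      have : (R j / R k) ^ 4 * (R j / R k) ^ 4 = R j / R k := by
        linear_combination (R j / R k) * h8
      rw [this]
      field_simp
    by_cases g1 : good 1
    · by_cases g2 : good 2
      · exact pair 1 2 (by omega) (by omega) (by omega) g1 g2
          (sqr _ _ (by omega) (by omega) g1 g2)
      · have g3 := bad 2 3 (by omega) (by omega) g2
        exact pair 1 3 (by omega) (by omega) (by omega) g1 g3
          (sqr _ _ (by omega) (by omega) g1 g3)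
    · have g2 := bad 1 2 (by omega) (by omega) g1
      have g3 := bad 1 3 (by omega) (by omega) g1
      exact pair 2 3 (by omega) (by omega) (by omega) g2 g3
          (sqr _ _ (by omega) (by omega) g2 g3)

/-- Non-zero solutions of `r² + s² = -1`. -/
theorem exists_sq_add_sq_eq_neg_one (F : Type u) [Field F] [Finite F] (hF : 8 ≤ Nat.card F) :
    ∃ r s : F, r ≠ 0 ∧ s ≠ 0 ∧ r * r + s * s = -1 := by
  obtain ⟨ν, hν, hgen, hord⟩ := exists_generator F
  have nd : ∀ m, 0 < m → m < 7 → ν ^ m ≠ 1 := fun m h0 h1 h2 => by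
    have := Nat.le_of_dvd h0 ((hord m).mp h2)
    omega
  by_cases h2 : (2 : F) = 0
  · have e : (-1 : F) = 1 := by linear_combination -h2
    refine ⟨ν, 1 + ν, hν, fun h => nd 1 (by omega) (by omega) ?_, ?_⟩
    · linear_combination h - h2
    · linear_combination (ν * ν + ν + 1) * h2
  · have hchar : ringChar F ≠ 2 := fun h => h2 (by
      have := ringChar.Nat.cast_ringChar (R := F)
      rw [h] at this
      exact_mod_cast this)
    have := Fintype.ofFinite F
    obtain ⟨r, s, hrs⟩ := FiniteField.exists_root_sum_quadratic (R := F)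
      (f := Polynomial.X ^ 2) (g := Polynomial.X ^ 2 - Polynomial.C (-1))
      (Polynomial.degree_X_pow 2) (Polynomial.degree_X_pow_sub_C (by decide) _)
      (FiniteField.odd_card_of_char_ne_two hchar)
    simp only [Polynomial.eval_pow, Polynomial.eval_X, Polynomial.eval_sub,
      Polynomial.eval_C] at hrs
    by_cases hr : r ≠ 0 ∧ s ≠ 0
    · exact ⟨r, s, hr.1, hr.2, by linear_combination hrs⟩
    obtain ⟨i, hi⟩ : ∃ i : F, i * i = -1 := by
      by_cases hr0 : r = 0
      · exact ⟨s, by rw [hr0] at hrs; linear_combination hrs⟩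
      · have hs0 : s = 0 := by
          by_contra hs0; exact hr ⟨hr0, hs0⟩
        exact ⟨r, by rw [hs0] at hrs; linear_combination hrs⟩
    have hi0 : i ≠ 0 := by rintro rfl; simp at hi
    have hp : 1 + ν ^ 2 ≠ 0 := fun h => nd 4 (by omega) (by omega) (by
      linear_combination (ν ^ 2 - 1) * h)
    have hm : 1 - ν ^ 2 ≠ 0 := fun h => nd 2 (by omega) (by omega) (by linear_combination -h)
    -- The rational parametrisation of the unit circle at `ν`, scaled by a square root `i` of `-1`.
    refine ⟨i * (1 - ν ^ 2) / (1 + ν ^ 2), i * (2 * ν) / (1 + ν ^ 2),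
      div_ne_zero (mul_ne_zero hi0 hm) hp,
      div_ne_zero (mul_ne_zero hi0 (mul_ne_zero h2 hν)) hp, ?_⟩
    field_simp
    linear_combination ((1 - ν ^ 2) ^ 2 + 4 * ν ^ 2) * hi

end

/-! ### Involutions of `PSL₂` as traceless matrices -/

section

variable {F : Type u} [Field F]

/-- The projection from `SL₂(F)` to `PSL₂(F)`. -/
abbrev proj (F : Type u) [Field F] :
    SpecialLinearGroup (Fin 2) F →* ProjectiveSpecialLinearGroup (Fin 2) F :=
  QuotientGroup.mk' (Subgroup.center (SpecialLinearGroup (Fin 2) F))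

theorem mem_center_iff_entries {M : SpecialLinearGroup (Fin 2) F} :
    M ∈ Subgroup.center (SpecialLinearGroup (Fin 2) F) ↔
      M 0 1 = 0 ∧ M 1 0 = 0 ∧ M 0 0 = M 1 1 := by
  rw [Matrix.SpecialLinearGroup.mem_center_iff]
  constructor
  · rintro ⟨r, -, hr⟩
    have e : ∀ i j, M i j = scalar (Fin 2) r i j := fun i j => by rw [hr]
    simp [e]
  · rintro ⟨h1, h2, h3⟩
    have hdet := M.2
    rw [det_fin_two] at hdet
    change M 0 0 * M 1 1 - M 0 1 * M 1 0 = 1 at hdet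
    refine ⟨M 0 0, ?_, ?_⟩
    · rw [Fintype.card_fin, sq]
      nth_rewrite 2 [h3]
      linear_combination hdet + M 0 1 * h2
    · ext i j
      fin_cases i <;> fin_cases j <;> simp [h1, h2, h3]

theorem proj_eq_one_iff {M : SpecialLinearGroup (Fin 2) F} :
    proj F M = 1 ↔ M 0 1 = 0 ∧ M 1 0 = 0 ∧ M 0 0 = M 1 1 := by
  rw [← mem_center_iff_entries]
  exact QuotientGroup.eq_one_iff M

theorem proj_surjective : Function.Surjective (proj F) := QuotientGroup.mk'_surjective _

theorem mul_entry (M N : SpecialLinearGroup (Fin 2) F) (i j : Fin 2) :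
    (M * N) i j = M i 0 * N 0 j + M i 1 * N 1 j := by
  change ((M : Matrix (Fin 2) (Fin 2) F) * (N : Matrix (Fin 2) (Fin 2) F)) i j = _
  rw [Matrix.mul_apply, Fin.sum_univ_two]

theorem det_entry (M : SpecialLinearGroup (Fin 2) F) : M 0 0 * M 1 1 - M 0 1 * M 1 0 = 1 := by
  have hdet := M.2
  rwa [det_fin_two] at hdet

theorem proj_mul_self {M : SpecialLinearGroup (Fin 2) F} (h : M 0 0 + M 1 1 = 0) :
    proj F M * proj F M = 1 := by
  rw [← map_mul, proj_eq_one_iff]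
  simp only [mul_entry]
  refine ⟨?_, ?_, ?_⟩
  · linear_combination M 0 1 * h
  · linear_combination M 1 0 * h
  · linear_combination (M 0 0 - M 1 1) * h

/-- The last hypothesis says `tr(MN) = 0`. So the images of `M`, `N` and `MN` all square to 1, which
forces commutation. -/
theorem proj_comm {M N : SpecialLinearGroup (Fin 2) F} (hM : M 0 0 + M 1 1 = 0)
    (hN : N 0 0 + N 1 1 = 0)
    (h : M 0 0 * N 0 0 + M 0 1 * N 1 0 + M 1 0 * N 0 1 + M 1 1 * N 1 1 = 0) :
    proj F M * proj F N = proj F N * proj F M := by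
  have h1 : proj F (M * N) * proj F (M * N) = 1 := proj_mul_self (by
    simp only [mul_entry]; linear_combination h)
  rw [map_mul] at h1
  rw [← inv_eq_of_mul_eq_one_left h1, _root_.mul_inv_rev, inv_eq_of_mul_eq_one_left (proj_mul_self hM),
    inv_eq_of_mul_eq_one_left (proj_mul_self hN)]

/-- The element of `SL₂(F)` with rows `(a, b)` and `(c, d)`. -/
def mk (a b c d : F) (h : a * d - b * c = 1) : SpecialLinearGroup (Fin 2) F :=
  ⟨!![a, b; c, d], by rw [det_fin_two_of, h]⟩

@[simp]
theorem mk_zero_zero (a b c d : F) (h : a * d - b * c = 1) : mk a b c d h 0 0 = a := rfl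

@[simp]
theorem mk_zero_one (a b c d : F) (h : a * d - b * c = 1) : mk a b c d h 0 1 = b := rfl

@[simp]
theorem mk_one_zero (a b c d : F) (h : a * d - b * c = 1) : mk a b c d h 1 0 = c := rfl

@[simp]
theorem mk_one_one (a b c d : F) (h : a * d - b * c = 1) : mk a b c d h 1 1 = d := rfl

theorem proj_not_comm : ¬ ∀ x y : ProjectiveSpecialLinearGroup (Fin 2) F, x * y = y * x := by
  intro h
  have h1 := h (proj F (mk 1 1 0 1 (by ring))) (proj F (mk 1 0 1 1 (by ring)))
  rw [← map_mul, ← map_mul] at h1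
  have h2 := QuotientGroup.eq.mp h1
  rw [mem_center_iff_entries] at h2
  have e1 : mk (1 : F) 1 0 1 (by ring) * mk 1 0 1 1 (by ring) = mk 2 1 1 1 (by ring) := by
    ext i j; fin_cases i <;> fin_cases j <;> (simp [mul_entry]; try norm_num)
  have e2 : mk (1 : F) 0 1 1 (by ring) * mk 1 1 0 1 (by ring) = mk 1 1 1 2 (by ring) := by
    ext i j; fin_cases i <;> fin_cases j <;> (simp [mul_entry]; try norm_num)
  have e3 : (mk (2 : F) 1 1 1 (by ring))⁻¹ = mk 1 (-1) (-1) 2 (by ring) := by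
    rw [inv_eq_iff_mul_eq_one]
    ext i j; fin_cases i <;> fin_cases j <;> (simp [mul_entry]; try norm_num)
  rw [e1, e2, e3] at h2
  simp [mul_entry] at h2
  norm_num at h2

theorem closure_proj_eq_top {S : Set (SpecialLinearGroup (Fin 2) F)}
    (h : Subgroup.closure S = ⊤) : Subgroup.closure (proj F '' S) = ⊤ := by
  rw [← MonoidHom.map_closure, h, Subgroup.map_top_of_surjective _ proj_surjective]

/-- A subgroup which contains the centre and covers generators of `PSL₂(F)` is everything. -/
theorem eq_top_of_closure_proj {S : Set (SpecialLinearGroup (Fin 2) F)}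
    (h : Subgroup.closure (proj F '' S) = ⊤) {P : Subgroup (SpecialLinearGroup (Fin 2) F)}
    (hc : Subgroup.center (SpecialLinearGroup (Fin 2) F) ≤ P) (hS : S ⊆ P) : P = ⊤ := by
  rw [← MonoidHom.map_closure] at h
  have h2 : Subgroup.map (proj F) P = ⊤ :=
    top_le_iff.mp (h ▸ Subgroup.map_mono ((Subgroup.closure_le P).mpr hS))
  have h3 := congrArg (Subgroup.comap (proj F)) h2
  rw [Subgroup.comap_map_eq, QuotientGroup.ker_mk', Subgroup.comap_top, sup_eq_left.mpr hc] at h3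
  exact h3

theorem flagReflections_of_entries {a b c a' b' c' a'' b'' c'' : F} (h : a * -a - b * c = 1)
    (h' : a' * -a' - b' * c' = 1) (h'' : a'' * -a'' - b'' * c'' = 1)
    (hac : 2 * (a * a'') + b * c'' + c * b'' = 0)
    (hgen : ∀ H : Subgroup (SpecialLinearGroup (Fin 2) F), Mem H a b c (-a) →
      Mem H a' b' c' (-a') → Mem H a'' b'' c'' (-a'') → H = ⊤) :
    GeneratedByFlagReflections (ProjectiveSpecialLinearGroup (Fin 2) F) := by
  refine ⟨proj F (mk _ _ _ _ h), proj F (mk _ _ _ _ h'), proj F (mk _ _ _ _ h''),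
    proj_mul_self ?_, proj_mul_self ?_, proj_mul_self ?_, proj_comm ?_ ?_ ?_, ?_⟩
  · simp
  · simp
  · simp
  · simp
  · simp
  · simp only [mk_zero_zero, mk_zero_one, mk_one_zero, mk_one_one]
    linear_combination hac
  · have := closure_proj_eq_top (F := F) (hgen (Subgroup.closure {mk _ _ _ _ h, mk _ _ _ _ h',
      mk _ _ _ _ h''}) ⟨mk _ _ _ _ h, Subgroup.subset_closure (by simp), rfl⟩
      ⟨mk _ _ _ _ h', Subgroup.subset_closure (by simp), rfl⟩
      ⟨mk _ _ _ _ h'', Subgroup.subset_closure (by simp), rfl⟩)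
    simpa only [Set.image_insert_eq, Set.image_singleton] using this

/-- Cayley–Hamilton: with trace `t` and determinant 1, `M³ = (t² - 1)M - t`. The entries listed
measure the distance from being scalar. -/
theorem cube_entries (M : SpecialLinearGroup (Fin 2) F) :
    (M ^ 3) 0 1 = M 0 1 * ((M 0 0 + M 1 1) ^ 2 - 1) ∧
    (M ^ 3) 1 0 = M 1 0 * ((M 0 0 + M 1 1) ^ 2 - 1) ∧
    (M ^ 3) 0 0 - (M ^ 3) 1 1 = (M 0 0 - M 1 1) * ((M 0 0 + M 1 1) ^ 2 - 1) := by
  have h := det_entry M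
  simp only [pow_succ M, pow_zero, one_mul, mul_entry]
  refine ⟨?_, ?_, ?_⟩
  · linear_combination -M 0 1 * h
  · linear_combination -M 1 0 * h
  · linear_combination (M 1 1 - M 0 0) * h

/-- Generators `x, y, z` with `zx` of order three and `zy` of order four. -/
theorem asymmetric_of_entries {a b c a' b' c' a'' b'' c'' : F} (h : a * -a - b * c = 1)
    (h' : a' * -a' - b' * c' = 1) (h'' : a'' * -a'' - b'' * c'' = 1)
    (hb : b ≠ 0 ∨ c ≠ 0) (hb' : b' ≠ 0 ∨ c' ≠ 0) (hb'' : b'' ≠ 0 ∨ c'' ≠ 0)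
    (hx : (2 * (a'' * a) + b'' * c + c'' * b) ^ 2 = 1)
    (hy : (2 * (a'' * a') + b'' * c' + c'' * b') ^ 2 = 2)
    (hy' : a'' * b' - b'' * a' ≠ 0 ∨ b'' * c' - c'' * b' ≠ 0)
    (hgen : ∀ H : Subgroup (SpecialLinearGroup (Fin 2) F), Mem H a b c (-a) →
      Mem H a' b' c' (-a') → Mem H a'' b'' c'' (-a'') → H = ⊤) :
    GeneratedByAsymmetricInvolutions (ProjectiveSpecialLinearGroup (Fin 2) F) := by
  refine ⟨proj F (mk _ _ _ _ h), proj F (mk _ _ _ _ h'), proj F (mk _ _ _ _ h''), 3,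
    proj_mul_self ?_, proj_mul_self ?_, proj_mul_self ?_, ?_, ?_, ?_, ?_, ?_, ?_⟩
  · simp
  · simp
  · simp
  · rw [Ne, proj_eq_one_iff]
    rintro ⟨h1, h2, -⟩
    exact hb.elim (· h1) (· h2)
  · rw [Ne, proj_eq_one_iff]
    rintro ⟨h1, h2, -⟩
    exact hb'.elim (· h1) (· h2)
  · rw [Ne, proj_eq_one_iff]
    rintro ⟨h1, h2, -⟩
    exact hb''.elim (· h1) (· h2)
  · have := closure_proj_eq_top (F := F) (hgen (Subgroup.closure {mk _ _ _ _ h, mk _ _ _ _ h',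
      mk _ _ _ _ h''}) ⟨mk _ _ _ _ h, Subgroup.subset_closure (by simp), rfl⟩
      ⟨mk _ _ _ _ h', Subgroup.subset_closure (by simp), rfl⟩
      ⟨mk _ _ _ _ h'', Subgroup.subset_closure (by simp), rfl⟩)
    simpa only [Set.image_insert_eq, Set.image_singleton] using this
  · rw [← map_mul, ← map_pow, proj_eq_one_iff, ← sub_eq_zero (b := (_ ^ 3 :
      SpecialLinearGroup (Fin 2) F) 1 1)]
    obtain ⟨e1, e2, e3⟩ := cube_entries (mk _ _ _ _ h'' * mk _ _ _ _ h)
    have e4 : ((mk _ _ _ _ h'' * mk _ _ _ _ h) 0 0 + (mk _ _ _ _ h'' * mk _ _ _ _ h) 1 1) ^ 2 - 1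
        = 0 := by
      simp only [mul_entry]
      simp only [mk_zero_zero, mk_zero_one, mk_one_zero, mk_one_one]
      linear_combination hx
    rw [e1, e2, e3, e4]
    simp
  · rw [← map_mul, ← map_pow, Ne, proj_eq_one_iff, ← sub_eq_zero (b := (_ ^ 3 :
      SpecialLinearGroup (Fin 2) F) 1 1)]
    obtain ⟨e1, e2, e3⟩ := cube_entries (mk _ _ _ _ h'' * mk _ _ _ _ h')
    -- As the squared trace is 2, the factor in `cube_entries` is 1, so the cube is scalar only if
    -- the matrix is; `hy'` excludes that.
    have e4 : ((mk _ _ _ _ h'' * mk _ _ _ _ h') 0 0 + (mk _ _ _ _ h'' * mk _ _ _ _ h') 1 1) ^ 2 - 1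
        = 1 := by
      simp only [mul_entry]
      simp only [mk_zero_zero, mk_zero_one, mk_one_zero, mk_one_one]
      linear_combination hy
    rw [e1, e2, e3, e4]
    simp only [mul_entry]
    simp only [mk_zero_zero, mk_zero_one, mk_one_zero, mk_one_one]
    rintro ⟨h1, -, h3⟩
    rcases hy' with hy' | hy'
    · exact hy' (by linear_combination h1)
    · exact hy' (by linear_combination h3)

/-! ### The automorphism inverting two generators -/

/-- Conjugation by an invertible matrix, as an automorphism of `SL₂(F)`. -/
def conj (N : GL (Fin 2) F) : SpecialLinearGroup (Fin 2) F ≃* SpecialLinearGroup (Fin 2) F where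
  toFun X := ⟨N.1 * X.1 * N⁻¹.1, by
    rw [det_mul, det_mul, X.2, mul_one, ← det_mul, ← Units.val_mul, mul_inv_cancel, Units.val_one,
      det_one]⟩
  invFun X := ⟨N⁻¹.1 * X.1 * N.1, by
    rw [det_mul, det_mul, X.2, mul_one, ← det_mul, ← Units.val_mul, inv_mul_cancel, Units.val_one,
      det_one]⟩
  left_inv X := Subtype.ext (by
    simp [mul_assoc])
  right_inv X := Subtype.ext (by
    simp [mul_assoc])
  map_mul' X Y := Subtype.ext (by
    change N.1 * (X.1 * Y.1) * N⁻¹.1 = (N.1 * X.1 * N⁻¹.1) * (N.1 * Y.1 * N⁻¹.1)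
    simp [mul_assoc])

/-- Put `N = AB - BA` and `t = tr A`. By Cayley–Hamilton `AN + NA = A²B - BA² = tN`, so `NA = (t -
A)N = A⁻¹N`. -/
theorem mul_commutator_mul {A : SpecialLinearGroup (Fin 2) F} (B : Matrix (Fin 2) (Fin 2) F) :
    A.1 * (A.1 * B - B * A.1) * A.1 = A.1 * B - B * A.1 := by
  have h := det_entry A
  change A.1 0 0 * A.1 1 1 - A.1 0 1 * A.1 1 0 = 1 at h
  rw [eta_fin_two A.1, eta_fin_two B]
  generalize A.1 0 0 = a at *
  generalize A.1 0 1 = b at *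
  generalize A.1 1 0 = c at *
  generalize A.1 1 1 = d at *
  simp only [mul_fin_two, sub_eq_add_neg, neg_of, neg_cons, neg_empty]
  ext i j
  fin_cases i <;> fin_cases j <;>
    simp only [Fin.zero_eta, Fin.mk_one, Fin.isValue, of_apply, cons_val_zero, cons_val_one,
      cons_val_fin_one, Matrix.mul_apply, Fin.sum_univ_two, Matrix.add_apply]
  · linear_combination (b * B 1 0 - B 0 1 * c) * h
  · linear_combination (a * B 0 1 + b * B 1 1 - B 0 0 * b - B 0 1 * d) * h
  · linear_combination (c * B 0 0 + d * B 1 0 - B 1 0 * a - B 1 1 * c) * h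
  · linear_combination (c * B 0 1 - B 1 0 * b) * h

end

section

variable {F : Type u} [Field F]

/-- The stabiliser of the line spanned by `v`. -/
def lineStabilizer (v : Fin 2 → F) (hv : v ≠ 0) : Subgroup (SpecialLinearGroup (Fin 2) F) where
  carrier := {M | ∃ t : F, M.1 *ᵥ v = t • v}
  one_mem' := ⟨1, by simp⟩
  mul_mem' := by
    rintro M N ⟨s, hs⟩ ⟨t, ht⟩
    refine ⟨t * s, ?_⟩
    change (M.1 * N.1) *ᵥ v = _
    rw [← mulVec_mulVec, ht, mulVec_smul, hs, smul_smul]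
  inv_mem' := by
    rintro M ⟨t, ht⟩
    have h1 : (M⁻¹).1 * M.1 = 1 := congrArg Subtype.val (inv_mul_cancel M)
    have h2 : v = t • ((M⁻¹).1 *ᵥ v) := by
      rw [← mulVec_smul, ← ht, mulVec_mulVec, h1, one_mulVec]
    have ht0 : t ≠ 0 := by
      rintro rfl
      rw [zero_smul] at h2
      exact hv h2
    refine ⟨t⁻¹, ?_⟩
    nth_rewrite 2 [h2]
    rw [smul_smul, inv_mul_cancel₀ ht0, one_smul]

theorem lineStabilizer_ne_top (v : Fin 2 → F) (hv : v ≠ 0) : lineStabilizer v hv ≠ ⊤ := by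
  intro h
  obtain ⟨s, hs⟩ : mk (1 : F) 1 0 1 (by ring) ∈ lineStabilizer v hv := h ▸ Subgroup.mem_top _
  obtain ⟨t, ht⟩ : mk (0 : F) 1 (-1) 0 (by ring) ∈ lineStabilizer v hv := h ▸ Subgroup.mem_top _
  have s0 := congrFun hs 0
  have s1 := congrFun hs 1
  have t0 := congrFun ht 0
  have t1 := congrFun ht 1
  simp only [mk, mulVec, dotProduct, Fin.sum_univ_two, of_apply, cons_val_zero, cons_val_one,
    cons_val_fin_one, Pi.smul_apply, smul_eq_mul] at s0 s1 t0 t1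
  have h1 : v 1 = 0 := by
    by_contra h1
    have : s = 1 := mul_right_cancel₀ h1 (by linear_combination -s1)
    rw [this] at s0
    exact h1 (by linear_combination s0)
  have h0 : v 0 = 0 := by
    rw [h1] at t1
    linear_combination -t1
  exact hv (by ext i; fin_cases i <;> assumption)

theorem center_le_lineStabilizer (v : Fin 2 → F) (hv : v ≠ 0) :
    Subgroup.center (SpecialLinearGroup (Fin 2) F) ≤ lineStabilizer v hv := by
  intro M hM
  obtain ⟨r, -, hr⟩ := Matrix.SpecialLinearGroup.mem_center_iff.mp hM
  refine ⟨r, ?_⟩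
  rw [← hr]
  ext i
  fin_cases i <;> simp [scalar_apply, mulVec, dotProduct, diagonal]

theorem center_ne_top : Subgroup.center (SpecialLinearGroup (Fin 2) F) ≠ ⊤ := by
  intro h
  apply proj_not_comm (F := F)
  intro x y
  obtain ⟨X, rfl⟩ := proj_surjective x
  obtain ⟨Y, rfl⟩ := proj_surjective y
  have : Y ∈ Subgroup.center (SpecialLinearGroup (Fin 2) F) := h ▸ Subgroup.mem_top _
  rw [← map_mul, ← map_mul, Subgroup.mem_center_iff.mp this X]

theorem conj_eq_inv {A : SpecialLinearGroup (Fin 2) F} {g : GL (Fin 2) F}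
    (h : A.1 * g.1 * A.1 = g.1) : conj g A = A⁻¹ := by
  have h1 : (A⁻¹).1 * A.1 = 1 := congrArg Subtype.val (inv_mul_cancel A)
  have h2 : g.1 * A.1 = (A⁻¹).1 * g.1 := by
    nth_rewrite 2 [← h]
    rw [← mul_assoc, ← mul_assoc, h1, one_mul]
  refine Subtype.ext ?_
  change g.1 * A.1 * g⁻¹.1 = (A⁻¹).1
  rw [h2, mul_assoc, ← Units.val_mul, mul_inv_cancel, Units.val_one, mul_one]

/-- Conjugation by `N = AB - BA` inverts `A` and `B` when `N` is invertible. A singular `N`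
contradicts generation: if `N = 0` then `A` and `B` are central, and otherwise both preserve the
line `ker N`. -/
theorem generatingPairsInvertible (F : Type u) [Field F] :
    GeneratingPairsInvertible (ProjectiveSpecialLinearGroup (Fin 2) F) := by
  intro a b hab
  obtain ⟨A, rfl⟩ := proj_surjective a
  obtain ⟨B, rfl⟩ := proj_surjective b
  have hgen : ∀ P : Subgroup (SpecialLinearGroup (Fin 2) F),
      Subgroup.center (SpecialLinearGroup (Fin 2) F) ≤ P → A ∈ P → B ∈ P → P = ⊤ := by
    intro P hc hA hB
    refine eq_top_of_closure_proj (S := {A, B}) ?_ hc (by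
      rintro x (rfl | rfl) <;> assumption)
    rw [Set.image_insert_eq, Set.image_singleton]
    exact hab
  have eA := mul_commutator_mul (A := A) B.1
  have eB : B.1 * (A.1 * B.1 - B.1 * A.1) * B.1 = A.1 * B.1 - B.1 * A.1 := by
    have := mul_commutator_mul (A := B) A.1
    rw [← neg_sub (B.1 * A.1) (A.1 * B.1), mul_neg, neg_mul, this]
  set N := A.1 * B.1 - B.1 * A.1 with hN
  by_cases hdet : N.det = 0
  · exfalso
    obtain ⟨v, hv, hNv⟩ := exists_mulVec_eq_zero_iff.mpr hdet
    by_cases hN0 : N = 0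
    · have hcomm : A * B = B * A := Subtype.ext (sub_eq_zero.mp (hN.symm.trans hN0))
      have key : ∀ X : SpecialLinearGroup (Fin 2) F, A * X = X * A → B * X = X * B →
          X ∈ Subgroup.center (SpecialLinearGroup (Fin 2) F) := by
        intro X hA hB
        have h := hgen (Subgroup.centralizer {X}) (Subgroup.center_le_centralizer _)
          (Subgroup.mem_centralizer_singleton_iff.mpr hA)
          (Subgroup.mem_centralizer_singleton_iff.mpr hB)
        rw [Subgroup.mem_center_iff]
        intro Y
        have : Y ∈ Subgroup.centralizer {X} := h ▸ Subgroup.mem_top Y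
        exact Subgroup.mem_centralizer_singleton_iff.mp this
      exact center_ne_top (hgen _ le_rfl (key A rfl hcomm.symm) (key B hcomm rfl))
    · have hker : ∀ w : Fin 2 → F, N *ᵥ w = 0 → ∃ t : F, w = t • v := by
        intro w hw
        have h0 := congrFun hNv 0
        have h1 := congrFun hNv 1
        have k0 := congrFun hw 0
        have k1 := congrFun hw 1
        simp only [mulVec, dotProduct, Fin.sum_univ_two, Pi.zero_apply] at h0 h1 k0 k1
        have hd : v 0 * w 1 = v 1 * w 0 := by
          by_contra hd
          have hd' : v 0 * w 1 - v 1 * w 0 ≠ 0 := sub_ne_zero.mpr hd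
          apply hN0
          ext i j
          fin_cases i <;> fin_cases j
          · exact (mul_eq_zero.mp (show (v 0 * w 1 - v 1 * w 0) * N 0 0 = 0 by
              linear_combination w 1 * h0 - v 1 * k0)).resolve_left hd'
          · exact (mul_eq_zero.mp (show (v 0 * w 1 - v 1 * w 0) * N 0 1 = 0 by
              linear_combination v 0 * k0 - w 0 * h0)).resolve_left hd'
          · exact (mul_eq_zero.mp (show (v 0 * w 1 - v 1 * w 0) * N 1 0 = 0 by
              linear_combination w 1 * h1 - v 1 * k1)).resolve_left hd'
          · exact (mul_eq_zero.mp (show (v 0 * w 1 - v 1 * w 0) * N 1 1 = 0 by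
              linear_combination v 0 * k1 - w 0 * h1)).resolve_left hd'
        by_cases hv0 : v 0 = 0
        · have hv1 : v 1 ≠ 0 := fun hv1 => hv (by ext i; fin_cases i <;> assumption)
          refine ⟨w 1 / v 1, ?_⟩
          ext i
          fin_cases i
          · simp only [Fin.zero_eta, Pi.smul_apply, smul_eq_mul]
            field_simp
            linear_combination -hd
          · simp only [Fin.mk_one, Pi.smul_apply, smul_eq_mul]
            field_simp
        · refine ⟨w 0 / v 0, ?_⟩
          ext i
          fin_cases i
          · simp only [Fin.zero_eta, Pi.smul_apply, smul_eq_mul]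
            field_simp
          · simp only [Fin.mk_one, Pi.smul_apply, smul_eq_mul]
            field_simp
            linear_combination hd
      -- `NX = X⁻¹N`, so `X` maps the kernel of `N` to itself.
      have key : ∀ X : SpecialLinearGroup (Fin 2) F, X.1 * N * X.1 = N →
          X ∈ lineStabilizer v hv := by
        intro X hX
        apply hker
        have h1 : (X⁻¹).1 * X.1 = 1 := congrArg Subtype.val (inv_mul_cancel X)
        have h2 : N * X.1 = (X⁻¹).1 * N := by
          nth_rewrite 2 [← hX]
          rw [← mul_assoc, ← mul_assoc, h1, one_mul]
        rw [mulVec_mulVec, h2, ← mulVec_mulVec, hNv, mulVec_zero]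
      exact lineStabilizer_ne_top v hv
        (hgen _ (center_le_lineStabilizer v hv) (key A eA) (key B eB))
  · let g : GL (Fin 2) F := GeneralLinearGroup.mkOfDetNeZero N hdet
    refine ⟨QuotientGroup.congr _ _ (conj g) (Subgroup.characteristic_iff_map_eq.mp inferInstance _),
      ?_, ?_⟩
    · change proj F (conj g A) = (proj F A)⁻¹
      rw [conj_eq_inv (g := g) eA, map_inv]
    · change proj F (conj g B) = (proj F B)⁻¹
      rw [conj_eq_inv (g := g) eB, map_inv]

end

/-! ### Explicit generating triples -/

section

variable {F : Type u} [Field F]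

theorem card_cast_eq_zero (F : Type u) [Field F] [Finite F] {n : ℕ} (h : Nat.card F = n) :
    (n : F) = 0 := by
  have := Fintype.ofFinite F
  rw [← h, Nat.card_eq_fintype_card]
  exact FiniteField.cast_card_eq_zero F

/-- The first two involutions have product `diag(ν, ν⁻¹)`, a generator of the torus. The third is
symmetric with no zero entry, which makes it commute with the first modulo the centre. -/
theorem flagReflections_of_torus (F : Type u) [Field F] [Finite F]
    (hF : 16 ≤ Nat.card F ∨ Nat.card F = 8) :
    GeneratedByFlagReflections (ProjectiveSpecialLinearGroup (Fin 2) F) := by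
  obtain ⟨ν, hν, hgen, -⟩ := exists_generator F
  obtain ⟨r, s, hr, hs, hrs⟩ := exists_sq_add_sq_eq_neg_one F (by omega)
  refine flagReflections_of_entries (a := 0) (b := 1) (c := -1) (a' := 0) (b' := -ν⁻¹) (c' := ν)
    (a'' := r) (b'' := s) (c'' := s) (by ring) (by field_simp; ring) (by linear_combination -hrs)
    (by ring) ?_
  intro H hA hB hC
  have hAB : Mem H ν 0 0 ν⁻¹ :=
    (hA.mul hB).congr (by ring) (by ring) (by ring) (by ring)
  have hpow : ∀ k : ℕ, Mem H (ν ^ k) 0 0 (ν ^ k)⁻¹ := by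
    intro k
    induction k with
    | zero => exact Mem.one.congr (by simp) rfl rfl (by simp)
    | succ k ih =>
      refine (ih.mul hAB).congr (by ring) (by ring) (by ring) ?_
      rw [pow_succ, _root_.mul_inv]
      ring
  refine eq_top_of_torus hF (fun l hl => ?_) hC hr hs hs (neg_ne_zero.mpr hr)
  obtain ⟨k, rfl⟩ := hgen l hl
  exact hpow k

/-- A subgroup of order greater than `p` of a group of order `p²`. -/
theorem addSubgroup_eq_top {A : Type u} [AddGroup A] [Finite A] {p : ℕ} (hp : p.Prime)
    (hA : Nat.card A = p ^ 2) (X : AddSubgroup A) (S : Finset A) (hS : ∀ x ∈ S, x ∈ X)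
    (hc : p < S.card) : X = ⊤ := by
  have h1 : S.card ≤ Nat.card X := by
    rw [← Fintype.card_coe S, ← Nat.card_eq_fintype_card]
    exact Nat.card_le_card_of_injective (fun x : S => (⟨x, hS x x.2⟩ : X))
      (fun x y h => Subtype.ext (congrArg (fun z : X => z.1) h))
  have h2 : Nat.card X ∣ p ^ 2 := hA ▸ AddSubgroup.card_addSubgroup_dvd_card X
  obtain ⟨k, hk, hk'⟩ := (Nat.dvd_prime_pow hp).mp h2
  have hk2 : k = 2 := by
    by_contra hne
    have : k ≤ 1 := by omega
    have := Nat.pow_le_pow_right hp.one_lt.le this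
    rw [pow_one] at this
    omega
  exact AddSubgroup.eq_top_of_card_eq X (by rw [hk', hk2, hA])

/-- The additive group has prime order, so one non-trivial unipotent yields all of them. -/
theorem eq_top_of_prime_card [Finite F] (hF : (Nat.card F).Prime)
    {H : Subgroup (SpecialLinearGroup (Fin 2) F)} {a b c d t : F} (ht : t ∈ unipotents H)
    (ht0 : t ≠ 0) (h : Mem H a b c d) (hc : c ≠ 0) : H = ⊤ := by
  refine eq_top_of_unipotents ?_ h hc
  have := Fact.mk hF
  rcases (unipotents H).eq_bot_or_eq_top_of_prime_card with hb | ht'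
  · rw [hb, AddSubgroup.mem_bot] at ht
    exact absurd ht ht0
  · exact ht'

theorem flagReflections_of_card_four [Finite F] (hF : Nat.card F = 4) :
    GeneratedByFlagReflections (ProjectiveSpecialLinearGroup (Fin 2) F) := by
  classical
  have h4 := card_cast_eq_zero F hF
  have h2 : (2 : F) = 0 := by
    have : (2 : F) * 2 = 0 := by exact_mod_cast h4
    exact mul_self_eq_zero.mp this
  obtain ⟨x, hx⟩ : ∃ x : F, x ∉ ({0, 1} : Finset F) := by
    by_contra! hx
    have := Nat.card_le_card_of_injective (fun y : F => (⟨y, hx y⟩ : ({0, 1} : Finset F)))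
      (fun y z h => by simpa using h)
    rw [Nat.card_eq_fintype_card (α := ({0, 1} : Finset F)), Fintype.card_coe, hF] at this
    exact absurd (this.trans Finset.card_le_two) (by norm_num)
  simp only [Finset.mem_insert, Finset.mem_singleton, not_or] at hx
  refine flagReflections_of_entries (a := 1) (b := 1) (c := 0) (a' := 0) (b' := 1) (c' := 1)
    (a'' := 1) (b'' := x) (c'' := 0) (by linear_combination -h2) (by linear_combination -h2)
    (by linear_combination -h2) (by linear_combination h2) ?_
  intro H hA hB hC
  -- In characteristic two the first and third involutions are themselves unipotent, with parameters
  -- 1 and `x`.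
  refine eq_top_of_unipotents (addSubgroup_eq_top Nat.prime_two hF _ {0, 1, x} ?_ ?_) hB one_ne_zero
  · simp only [Finset.mem_insert, Finset.mem_singleton, forall_eq_or_imp, forall_eq]
    refine ⟨zero_mem _, ?_, ?_⟩
    · exact hA.congr rfl rfl rfl (by linear_combination -h2)
    · exact hC.congr rfl rfl rfl (by linear_combination -h2)
  · rw [Finset.card_eq_three.mpr ⟨0, 1, x, zero_ne_one, Ne.symm hx.1, Ne.symm hx.2, rfl⟩]
    norm_num

/-- `diag(i, -i)` commutes modulo the centre with the Weyl element, and `A⁻¹B` is the unipotent with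
parameter 1. -/
theorem flagReflections_of_prime [Finite F] (hF : (Nat.card F).Prime) {i : F} (hi : i * i = -1) :
    GeneratedByFlagReflections (ProjectiveSpecialLinearGroup (Fin 2) F) := by
  refine flagReflections_of_entries (a := i) (b := 0) (c := 0) (a' := i) (b' := i) (c' := 0)
    (a'' := 0) (b'' := 1) (c'' := -1) (by linear_combination -hi) (by linear_combination -hi)
    (by ring) (by ring) ?_
  intro H hA hB hC
  exact eq_top_of_prime_card hF (t := 1) ((hA.inv.mul hB).congr (by linear_combination -hi)
    (by linear_combination -hi) (by ring) (by linear_combination -hi)) one_ne_zero hC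
    (neg_ne_zero.mpr one_ne_zero)

theorem flagReflections_of_card_eleven [Finite F] (hF : Nat.card F = 11) :
    GeneratedByFlagReflections (ProjectiveSpecialLinearGroup (Fin 2) F) := by
  have h11 : (11 : F) = 0 := by exact_mod_cast card_cast_eq_zero F hF
  refine flagReflections_of_entries (a := 0) (b := 1) (c := -1) (a' := 1) (b' := 2) (c' := -1)
    (a'' := 1) (b'' := 3) (c'' := 3) (by ring) (by ring) (by linear_combination -h11)
    (by ring) ?_
  intro H hA hB hC
  -- A word equal to minus a unipotent; its square has parameter `-10 = 1`.
  have hW : Mem H (-1) 5 0 (-1) :=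
    ((((((hA.mul hB).mul hA).mul hB).mul hC).mul hB).mul hC).congr
      (by linear_combination 6 * h11) (by ring) (by linear_combination 10 * h11)
      (by linear_combination h11)
  refine eq_top_of_prime_card (by rw [hF]; norm_num) (hW.two_mul_mem_unipotents (by ring)) ?_ hA
    (neg_ne_zero.mpr one_ne_zero)
  intro h0
  exact one_ne_zero (show (1 : F) = 0 by linear_combination h11 + h0)

theorem asymmetric_of_card_seven [Finite F] (hF : Nat.card F = 7) :
    GeneratedByAsymmetricInvolutions (ProjectiveSpecialLinearGroup (Fin 2) F) := by
  have h7 : (7 : F) = 0 := by exact_mod_cast card_cast_eq_zero F hF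
  refine asymmetric_of_entries (a := 2) (b := 1) (c := 2) (a' := 1) (b' := 1) (c' := -2)
    (a'' := 0) (b'' := 1) (c'' := -1) (by linear_combination -h7) (by ring) (by ring)
    (Or.inl one_ne_zero) (Or.inl one_ne_zero) (Or.inl one_ne_zero) (by ring)
    (by linear_combination h7) (Or.inl (by norm_num)) ?_
  intro H hx hy hz
  -- Already `zxy` is minus a unipotent, and its square has parameter `-8 = -1`.
  have hW : Mem H (-1) 4 0 (-1) := ((hz.mul hx).mul hy).congr (by linear_combination h7) (by ring)
    (by ring) (by ring)
  refine eq_top_of_prime_card (by rw [hF]; norm_num) (hW.two_mul_mem_unipotents (by ring)) ?_ hz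
    (neg_ne_zero.mpr one_ne_zero)
  intro h0
  exact one_ne_zero (show (1 : F) = 0 by linear_combination -h7 - h0)

theorem asymmetric_of_card_nine [Finite F] (hF : Nat.card F = 9) :
    GeneratedByAsymmetricInvolutions (ProjectiveSpecialLinearGroup (Fin 2) F) := by
  classical
  have h9 := card_cast_eq_zero F hF
  have h3 : (3 : F) = 0 := by
    have : (3 : F) * 3 = 0 := by
      have e : ((9 : ℕ) : F) = 3 * 3 := by norm_num
      rw [← e]; exact h9
    exact mul_self_eq_zero.mp this
  obtain ⟨i, hi⟩ : ∃ i : F, i * i = -1 := by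
    have := Fintype.ofFinite F
    obtain ⟨i, hi⟩ := FiniteField.isSquare_neg_one_iff.mpr (show Fintype.card F % 4 ≠ 3 by
      rw [← Nat.card_eq_fintype_card, hF]; norm_num)
    exact ⟨i, hi.symm⟩
  have hne : ∀ x y : F, x * y = 1 → x ≠ 0 := fun x y h h0 => by simp [h0] at h
  refine asymmetric_of_entries (a := i) (b := 0) (c := 1) (a' := 0) (b' := 1 + i) (c' := 1 - i)
    (a'' := 0) (b'' := 1) (c'' := -1) (by linear_combination -hi)
    (by linear_combination hi - h3) (by ring)
    (Or.inr one_ne_zero) (Or.inl (hne _ (i - 1) (by linear_combination hi - h3)))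
    (Or.inl one_ne_zero) (by ring) (by linear_combination 4 * hi - 2 * h3)
    (Or.inr (hne _ 2 (by linear_combination h3))) ?_
  intro H hx hy hz
  -- Two words give unipotents with parameters `i` and 2, independent over the prime field; with 0
  -- and 1 this is more than three parameters, enough to fill a group of order 9.
  have hW : Mem H 1 i 0 1 := ((((hz.mul hx).mul hy).mul hz).mul hy).congr
    (by linear_combination (2 - i) * hi - h3) (by linear_combination -hi - i * h3) (by ring)
    (by linear_combination (2 + i) * hi - h3)
  have hV : Mem H 1 2 0 1 := ((((hz.mul hy).mul hz).mul hx).mul hy).congr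
    (by linear_combination (2 - i) * hi - h3) (by linear_combination -hi) (by ring)
    (by linear_combination (2 + i) * hi - h3)
  have i0 : i ≠ 0 := hne _ (-i) (by linear_combination -hi)
  have i1 : i ≠ 1 := fun h => one_ne_zero (show (1 : F) = 0 by
    rw [h] at hi; linear_combination h3 - hi)
  have i2 : i ≠ 2 := fun h => one_ne_zero (show (1 : F) = 0 by
    rw [h] at hi; linear_combination 2 * h3 - hi)
  have h10 : (1 : F) ≠ 0 := one_ne_zero
  have h20 : (2 : F) ≠ 0 := hne _ 2 (by linear_combination h3)
  have h21 : (2 : F) ≠ 1 := fun h => h10 (by linear_combination h)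
  refine eq_top_of_unipotents (addSubgroup_eq_top Nat.prime_three hF _ {0, 1, 2, i} ?_ ?_) hz
    (neg_ne_zero.mpr one_ne_zero)
  · have h2m : (2 : F) ∈ unipotents H := hV
    have h1m : (1 : F) ∈ unipotents H := by
      have : (1 : F) = 2 + 2 := by linear_combination -h3
      rw [this]
      exact add_mem h2m h2m
    simp only [Finset.mem_insert, Finset.mem_singleton, forall_eq_or_imp, forall_eq]
    exact ⟨zero_mem _, h1m, h2m, hW⟩
  · rw [Finset.card_insert_of_notMem, Finset.card_eq_three.mpr ⟨1, 2, i, h21.symm, i1.symm,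
      i2.symm, rfl⟩]
    · norm_num
    · simp [h10.symm, h20.symm, i0.symm]

end

/-- The standard bilinear form on triples. -/
def dot {R : Type u} [CommRing R] (v w : R × R × R) : R :=
  v.1 * w.1 + v.2.1 * w.2.1 + v.2.2 * w.2.2

/-- The half-turn about the line spanned by a unit vector `w`. -/
def halfTurn {R : Type u} [CommRing R] (w v : R × R × R) : R × R × R :=
  (2 * dot v w * w.1 - v.1, 2 * dot v w * w.2.1 - v.2.1, 2 * dot v w * w.2.2 - v.2.2)

/-! ### Pure quaternions, half-turns and small stable sets -/

section

variable {F : Type u} [Field F]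

/-- The pure quaternion with coordinates `v`, for anticommuting square roots `I`, `J` of `-1`. -/
def quat (I J : Matrix (Fin 2) (Fin 2) F) (v : F × F × F) : Matrix (Fin 2) (Fin 2) F :=
  v.1 • I + v.2.1 • J + v.2.2 • (I * J)

/-- The polarisation of `X² = -det X` for traceless matrices. -/
theorem anticommutator_of_trace_eq_zero {X Y : Matrix (Fin 2) (Fin 2) F} (hX : X.trace = 0)
    (hY : Y.trace = 0) : X * Y + Y * X = (X * Y).trace • (1 : Matrix (Fin 2) (Fin 2) F) := by
  rw [trace_fin_two] at *
  ext i j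
  fin_cases i <;> fin_cases j <;>
    simp only [Fin.zero_eta, Fin.mk_one, Fin.isValue, Matrix.add_apply, Matrix.mul_apply,
      Fin.sum_univ_two, Matrix.smul_apply, smul_eq_mul, one_apply_eq, mul_one, ne_eq, zero_ne_one,
      one_ne_zero, not_false_eq_true, one_apply_ne, mul_zero]
  · linear_combination Y 0 0 * hX - X 1 1 * hY
  · linear_combination Y 0 1 * hX + X 0 1 * hY
  · linear_combination Y 1 0 * hX + X 1 0 * hY
  · linear_combination Y 1 1 * hX - X 0 0 * hY

theorem mul_self_of_trace_eq_zero (M : SpecialLinearGroup (Fin 2) F) (hM : M.1.trace = 0) :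
    M.1 * M.1 = -1 := by
  have h := det_entry M
  change M.1 0 0 * M.1 1 1 - M.1 0 1 * M.1 1 0 = 1 at h
  rw [trace_fin_two] at hM
  ext i j
  fin_cases i <;> fin_cases j <;>
    simp only [Fin.zero_eta, Fin.mk_one, Fin.isValue, Matrix.neg_apply, Matrix.mul_apply,
      Fin.sum_univ_two, one_apply_eq, ne_eq, zero_ne_one,
      one_ne_zero, not_false_eq_true, one_apply_ne, neg_zero]
  · linear_combination M.1 0 0 * hM - h
  · linear_combination M.1 0 1 * hM
  · linear_combination M.1 1 0 * hM
  · linear_combination M.1 1 1 * hM - h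

variable {I J : Matrix (Fin 2) (Fin 2) F} (hI : I * I = -1) (hJ : J * J = -1)
  (hJI : J * I = -(I * J))

include hI hJ hJI

theorem quat_anticommutator (v w : F × F × F) :
    quat I J v * quat I J w + quat I J w * quat I J v =
      (-2 * dot v w) • (1 : Matrix (Fin 2) (Fin 2) F) := by
  have hI' : ∀ X, I * (I * X) = -X := fun X => by rw [← mul_assoc, hI, neg_one_mul]
  have hJI' : ∀ X, J * (I * X) = -(I * (J * X)) := fun X => by
    rw [← mul_assoc, hJI, neg_mul, mul_assoc]
  simp only [quat, dot, add_mul, mul_add, smul_mul_assoc, mul_smul_comm, mul_assoc, hI, hJ, hJI,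
    hI', hJI', mul_neg, mul_one, neg_neg]
  module

theorem quat_mul_self (h2 : (2 : F) ≠ 0) (v : F × F × F) :
    quat I J v * quat I J v = (-dot v v) • (1 : Matrix (Fin 2) (Fin 2) F) := by
  have h := quat_anticommutator hI hJ hJI v v
  rw [← two_smul F, neg_mul, ← mul_neg, mul_smul] at h
  exact smul_right_injective _ h2 h

/-- The anticommutators with the three basis quaternions recover the coordinates, as `2 ≠ 0`. -/
theorem quat_injective (h2 : (2 : F) ≠ 0) : Function.Injective (quat I J) := by
  intro v w h
  have key : ∀ e : F × F × F, dot v e = dot w e := by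
    intro e
    have h1 := quat_anticommutator hI hJ hJI v e
    rw [h, quat_anticommutator hI hJ hJI w e] at h1
    have h3 := congrFun (congrFun h1 0) 0
    simp only [Matrix.smul_apply, one_apply_eq, smul_eq_mul, mul_one] at h3
    exact (mul_left_cancel₀ (neg_ne_zero.mpr h2) h3).symm
  have k1 := key (1, 0, 0)
  have k2 := key (0, 1, 0)
  have k3 := key (0, 0, 1)
  simp only [dot, mul_one, mul_zero, add_zero, zero_add] at k1 k2 k3
  exact Prod.ext k1 (Prod.ext k2 k3)

/-- `-w` is the inverse of a unit pure quaternion `w`. Moving `w` past `v` costs the anticommutator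
`-2 (v · w)`, which gives `2 (v · w) w - v`. -/
theorem quat_halfTurn {w : F × F × F} (hw : dot w w = 1) (h2 : (2 : F) ≠ 0) (v : F × F × F) :
    quat I J w * quat I J v * -quat I J w = quat I J (halfTurn w v) := by
  have h1 := quat_anticommutator hI hJ hJI v w
  have h3 := quat_mul_self hI hJ hJI h2 w
  rw [hw] at h3
  have h4 : quat I J w * quat I J v =
      (-2 * dot v w) • (1 : Matrix (Fin 2) (Fin 2) F) - quat I J v * quat I J w := by
    rw [← h1]; abel
  rw [h4, mul_neg, sub_mul, mul_assoc, h3]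
  have h5 : quat I J (halfTurn w v) = (2 * dot v w) • quat I J w - quat I J v := by
    simp only [quat, halfTurn]
    module
  rw [h5]
  simp only [smul_mul_assoc, one_mul, mul_smul_comm, mul_one]
  module

/-- Let `Y` be `X` minus its orthogonal projection to the span of `I, J, IJ` for the trace form.
Then `Y` anticommutes with all three; but anticommuting with `I` and `J` means commuting with `IJ`,
so `2 IJ Y = 0` and `Y = 0`. -/
theorem exists_quat_eq (h2 : (2 : F) ≠ 0) (hI0 : I.trace = 0) (hJ0 : J.trace = 0)
    (hIJ0 : (I * J).trace = 0) {X : Matrix (Fin 2) (Fin 2) F} (hX : X.trace = 0) :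
    ∃ w, X = quat I J w := by
  let w : F × F × F := (-(X * I).trace / 2, -(X * J).trace / 2, -(X * (I * J)).trace / 2)
  refine ⟨w, ?_⟩
  have anti : ∀ e : F × F × F, (X * quat I J e).trace = -2 * dot w e →
      (quat I J e).trace = 0 →
      (X - quat I J w) * quat I J e = -(quat I J e * (X - quat I J w)) := by
    intro e he he0
    have h1 := anticommutator_of_trace_eq_zero hX he0
    have h3 := quat_anticommutator hI hJ hJI w e
    rw [he, ← h3] at h1
    rw [sub_mul, mul_sub, eq_neg_iff_add_eq_zero]
    rw [← sub_eq_zero] at h1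
    rw [← h1]
    abel
  have aI := anti (1, 0, 0) (by simp [quat, dot, w]; field_simp) (by simp [quat, hI0])
  have aJ := anti (0, 1, 0) (by simp [quat, dot, w]; field_simp) (by simp [quat, hJ0])
  have aK := anti (0, 0, 1) (by simp [quat, dot, w]; field_simp) (by simp [quat, hIJ0])
  set Y := X - quat I J w with hY
  simp only [quat, one_smul, zero_smul, add_zero, zero_add] at aI aJ aK
  have c : Y * (I * J) = I * J * Y := by
    rw [← mul_assoc, aI, neg_mul, mul_assoc, aJ, mul_neg, neg_neg, mul_assoc]
  rw [aK] at c
  have c2 : (2 : F) • (I * J * Y) = 0 := by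
    rw [two_smul]
    nth_rewrite 1 [← c]
    exact neg_add_cancel _
  have c3 : I * J * Y = 0 := (smul_eq_zero.mp c2).resolve_left h2
  have c4 : (I * J) * (I * J) = -1 := by
    rw [mul_assoc, ← mul_assoc J, hJI, neg_mul, mul_assoc, hJ, mul_neg, ← mul_assoc, hI]
    simp
  have c5 : Y = 0 := by
    have : (I * J) * (I * J * Y) = 0 := by rw [c3, mul_zero]
    rwa [← mul_assoc, c4, neg_one_mul, neg_eq_zero] at this
  exact sub_eq_zero.mp c5

end

/-- The elements conjugating a set of matrices to itself. -/
def setStabilizer {F : Type u} [Field F] (T : Set (Matrix (Fin 2) (Fin 2) F)) :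
    Subgroup (SpecialLinearGroup (Fin 2) F) where
  carrier := {M | ∀ X ∈ T, M.1 * X * (M⁻¹).1 ∈ T ∧ (M⁻¹).1 * X * M.1 ∈ T}
  one_mem' := by
    intro X hX
    rw [inv_one]
    change (1 : Matrix (Fin 2) (Fin 2) F) * X * 1 ∈ T ∧ (1 : Matrix (Fin 2) (Fin 2) F) * X * 1 ∈ T
    simpa using hX
  mul_mem' := by
    intro M N hM hN X hX
    rw [_root_.mul_inv_rev]
    change (M.1 * N.1) * X * ((N⁻¹).1 * (M⁻¹).1) ∈ T ∧ ((N⁻¹).1 * (M⁻¹).1) * X * (M.1 * N.1) ∈ T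
    have h1 := (hM _ (hN X hX).1).1
    have h2 := (hN _ (hM X hX).2).2
    simp only [mul_assoc] at *
    exact ⟨h1, h2⟩
  inv_mem' := by
    intro M hM X hX
    rw [inv_inv]
    exact (hM X hX).symm

theorem center_le_setStabilizer {F : Type u} [Field F] (T : Set (Matrix (Fin 2) (Fin 2) F)) :
    Subgroup.center (SpecialLinearGroup (Fin 2) F) ≤ setStabilizer T := by
  have key : ∀ M ∈ Subgroup.center (SpecialLinearGroup (Fin 2) F),
      ∀ X : Matrix (Fin 2) (Fin 2) F, M.1 * X * (M⁻¹).1 = X := by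
    intro M hM X
    obtain ⟨r, -, hr⟩ := Matrix.SpecialLinearGroup.mem_center_iff.mp hM
    have h1 : M.1 * (M⁻¹).1 = 1 := congrArg Subtype.val (mul_inv_cancel M)
    have h2 : M.1 * X = X * M.1 := by
      rw [← hr]
      exact scalar_commute r (Commute.all r) X
    rw [h2, mul_assoc, h1, mul_one]
  intro M hM X hX
  have h1 := key M hM X
  have h2 := key M⁻¹ (inv_mem hM) X
  rw [inv_inv] at h2
  rw [h1, h2]
  exact ⟨hX, hX⟩

/-- A finite set of traceless non-nilpotent matrices which is normalised by the unipotent upper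
triangular matrices is a union of regular orbits. -/
theorem card_dvd_of_setStabilizer_eq_top {F : Type u} [Field F] [Finite F] (h2 : (2 : F) ≠ 0)
    (T : Finset (Matrix (Fin 2) (Fin 2) F))
    (hT : setStabilizer (T : Set (Matrix (Fin 2) (Fin 2) F)) = ⊤)
    (h0 : ∀ X ∈ T, X.trace = 0) (h1 : ∀ X ∈ T, X * X ≠ 0) : Nat.card F ∣ T.card := by
  classical
  have hinv : ∀ t : F, (mk 1 t 0 1 (by ring))⁻¹ = mk 1 (-t) 0 1 (by ring) := by
    intro t
    rw [inv_eq_iff_mul_eq_one]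
    ext i j; fin_cases i <;> fin_cases j <;> simp [mul_entry]
  have hadd : ∀ s t : F, mk 1 (s + t) 0 1 (by ring) = mk 1 s 0 1 (by ring) * mk 1 t 0 1 (by ring) := by
    intro s t
    ext i j; fin_cases i <;> fin_cases j <;> simp [mul_entry, add_comm]
  have hmem : ∀ (t : F), ∀ X ∈ T, (mk 1 t 0 1 (by ring)).1 * X * (mk 1 (-t) 0 1 (by ring)).1 ∈ T := by
    intro t X hX
    have : mk 1 t 0 1 (by ring) ∈ setStabilizer (T : Set (Matrix (Fin 2) (Fin 2) F)) :=
      hT ▸ Subgroup.mem_top _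
    have := (this X hX).1
    rwa [hinv] at this
  let _ : AddAction F T :=
    { vadd := fun t X => ⟨_, hmem t X.1 X.2⟩
      zero_vadd := fun X => Subtype.ext (by
        change (mk 1 0 0 1 _).1 * X.1 * (mk 1 (-0) 0 1 _).1 = X.1
        have e : ∀ z : F, z = 0 → ∀ h, (mk 1 z 0 1 h).1 = 1 := by
          rintro _ rfl h
          simp [mk, one_fin_two]
        rw [e _ rfl, e _ neg_zero, one_mul, mul_one])
      add_vadd := fun s t X => Subtype.ext (by
        change (mk 1 (s + t) 0 1 _).1 * X.1 * (mk 1 (-(s + t)) 0 1 _).1 =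
          (mk 1 s 0 1 _).1 * ((mk 1 t 0 1 _).1 * X.1 * (mk 1 (-t) 0 1 _).1) * (mk 1 (-s) 0 1 _).1
        have e1 : (mk 1 (s + t) 0 1 (by ring)).1 =
            (mk 1 s 0 1 (by ring)).1 * (mk 1 t 0 1 (by ring)).1 := congrArg Subtype.val (hadd s t)
        have e2 : (mk 1 (-(s + t)) 0 1 (by ring)).1 =
            (mk 1 (-t) 0 1 (by ring)).1 * (mk 1 (-s) 0 1 (by ring)).1 := by
          simp only [neg_add_rev]
          exact congrArg Subtype.val (hadd (-t) (-s))
        rw [e1, e2]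
        simp only [mul_assoc]) }
  -- A traceless matrix commuting with a non-trivial upper unipotent is strictly upper triangular,
  -- hence squares to zero.
  have hfix : ∀ t : F, t ≠ 0 → ∀ X : T, t +ᵥ X ≠ X := by
    intro t ht X hX
    have e := congrArg Subtype.val hX
    change (mk 1 t 0 1 _).1 * X.1 * (mk 1 (-t) 0 1 _).1 = X.1 at e
    have e10 := congrFun (congrFun e 0) 0
    have e01 := congrFun (congrFun e 0) 1
    have htr := h0 X.1 X.2
    rw [trace_fin_two] at htr
    simp only [mk, Matrix.mul_apply, Fin.sum_univ_two, of_apply, cons_val_zero, cons_val_one,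
      cons_val_fin_one] at e10 e01
    have z0 : X.1 1 0 = 0 := by
      have : t * X.1 1 0 = 0 := by linear_combination e10
      exact (mul_eq_zero.mp this).resolve_left ht
    have x0 : X.1 0 0 = 0 := by
      have : (2 * t) * X.1 0 0 = 0 := by
        rw [z0] at e01
        linear_combination t * htr - e01
      exact (mul_eq_zero.mp this).resolve_left (mul_ne_zero h2 ht)
    have y0 : X.1 1 1 = 0 := by linear_combination htr - x0
    apply h1 X.1 X.2
    ext i j
    fin_cases i <;> fin_cases j <;> simp [Matrix.mul_apply, Fin.sum_univ_two, z0, x0, y0]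
  have := Fintype.ofFinite F
  have := Fintype.ofFinite (Quotient (AddAction.orbitRel F T))
  -- Burnside's count: only the identity contributes fixed points, so `|T|` is the number of orbits
  -- times `|F|`.
  have hb := AddAction.sum_card_fixedBy_eq_card_orbits_mul_card_addGroup F T
  rw [Finset.sum_eq_single (0 : F)] at hb
  · have hc : Fintype.card (AddAction.fixedBy T (0 : F)) = T.card := by
      rw [← Fintype.card_coe]
      exact Fintype.card_congr (Equiv.subtypeUnivEquiv (fun X => zero_vadd F X))
    rw [hc] at hb
    rw [hb, Nat.card_eq_fintype_card]
    exact Dvd.intro_left _ rfl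
  · intro t _ ht
    rw [Fintype.card_eq_zero_iff]
    exact ⟨fun X => hfix t ht X.1 X.2⟩
  · intro h
    exact absurd (Finset.mem_univ _) h

/-- Three half-turns generating `PSL₂(F)`, the first two commuting, cannot preserve a small set of
non-isotropic vectors. -/
theorem exists_unit_card_dvd {F : Type u} [Field F] [Finite F] (h2 : (2 : F) ≠ 0)
    {A B C : SpecialLinearGroup (Fin 2) F} (hA : A.1.trace = 0) (hB : B.1.trace = 0)
    (hC : C.1.trace = 0) (hAC : (A.1 * C.1).trace = 0)
    (hgen : Subgroup.closure (proj F '' {A, B, C}) = ⊤) :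
    ∃ w : F × F × F, dot w w = 1 ∧ ∀ S : Finset (F × F × F), (∀ v ∈ S, dot v v ≠ 0) →
      (∀ v ∈ S, halfTurn (1, 0, 0) v ∈ S) → (∀ v ∈ S, halfTurn (0, 1, 0) v ∈ S) →
      (∀ v ∈ S, halfTurn w v ∈ S) → Nat.card F ∣ S.card := by
  classical
  have hI := mul_self_of_trace_eq_zero A hA
  have hJ := mul_self_of_trace_eq_zero C hC
  have hJI : C.1 * A.1 = -(A.1 * C.1) := by
    have := anticommutator_of_trace_eq_zero hA hC
    rw [hAC, zero_smul] at this
    exact eq_neg_of_add_eq_zero_right this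
  obtain ⟨w, hw⟩ := exists_quat_eq hI hJ hJI h2 hA hC hAC hB
  have hww : dot w w = 1 := by
    have h := mul_self_of_trace_eq_zero B hB
    rw [hw, quat_mul_self hI hJ hJI h2] at h
    have h3 := congrFun (congrFun h 0) 0
    simp only [Matrix.smul_apply, Matrix.neg_apply, one_apply_eq, smul_eq_mul, mul_one] at h3
    exact neg_injective h3
  refine ⟨w, hww, fun S hS0 hSA hSC hSB => ?_⟩
  have hinj := quat_injective hI hJ hJI h2
  rw [← Finset.card_image_of_injective S hinj]
  have hstab : ∀ (Y : SpecialLinearGroup (Fin 2) F) (y : F × F × F), Y.1 = quat A.1 C.1 y →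
      Y.1.trace = 0 → dot y y = 1 → (∀ v ∈ S, halfTurn y v ∈ S) →
      Y ∈ setStabilizer (S.image (quat A.1 C.1) : Set (Matrix (Fin 2) (Fin 2) F)) := by
    intro Y y hY hY0 hy hSy X hX
    have hYY := mul_self_of_trace_eq_zero Y hY0
    -- Since `Y² = -1`, conjugation by `Y` and by `Y⁻¹` coincide, so both conditions defining the
    -- stabiliser are the same half-turn.
    have hYi : (Y⁻¹).1 = -Y.1 := by
      have h1 : (Y⁻¹).1 * Y.1 = 1 := congrArg Subtype.val (inv_mul_cancel Y)
      have h3 : (Y⁻¹).1 * Y.1 * Y.1 = Y.1 := by rw [h1, one_mul]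
      rw [mul_assoc, hYY, mul_neg, mul_one] at h3
      rw [← h3, neg_neg]
    obtain ⟨v, hv, rfl⟩ := Finset.mem_image.mp (Finset.mem_coe.mp hX)
    have key : Y.1 * quat A.1 C.1 v * -Y.1 ∈ S.image (quat A.1 C.1) := by
      rw [hY, quat_halfTurn hI hJ hJI hy h2]
      exact Finset.mem_image_of_mem _ (hSy v hv)
    rw [hYi, neg_mul, neg_mul, ← mul_neg]
    exact ⟨key, key⟩
  refine card_dvd_of_setStabilizer_eq_top h2 _
    (eq_top_of_closure_proj hgen (center_le_setStabilizer _) ?_) ?_ ?_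
  · rintro Y (rfl | rfl | rfl)
    · exact hstab Y (1, 0, 0) (by simp [quat]) hA (by simp [dot]) hSA
    · exact hstab Y w hw hB hww hSB
    · exact hstab Y (0, 1, 0) (by simp [quat]) hC (by simp [dot]) hSC
  · intro X hX
    obtain ⟨v, hv, rfl⟩ := Finset.mem_image.mp hX
    simp [quat, trace_add, trace_smul, hA, hC, hAC]
  · intro X hX h
    obtain ⟨v, hv, rfl⟩ := Finset.mem_image.mp hX
    rw [quat_mul_self hI hJ hJI h2] at h
    have h3 := congrFun (congrFun h 0) 0
    simp only [Matrix.smul_apply, one_apply_eq, smul_eq_mul, mul_one, Matrix.zero_apply] at h3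
    exact hS0 v hv (neg_eq_zero.mp h3)

/-- `M² = (tr M) M - 1`, so if `M²` is scalar and `M` is not, the trace vanishes. This lifts
involutions to traceless matrices. -/
theorem trace_eq_zero_of_proj {F : Type u} [Field F] {M : SpecialLinearGroup (Fin 2) F}
    (h : proj F M * proj F M = 1) (h1 : proj F M ≠ 1) : M.1.trace = 0 := by
  rw [← map_mul, proj_eq_one_iff] at h
  simp only [mul_entry] at h
  rw [trace_fin_two]
  change M 0 0 + M 1 1 = 0
  obtain ⟨h2, h3, h4⟩ := h
  by_contra h0
  refine h1 (proj_eq_one_iff.mpr ⟨?_, ?_, ?_⟩)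
  · exact (mul_eq_zero.mp (show (M 0 0 + M 1 1) * M 0 1 = 0 by
      linear_combination h2)).resolve_left h0
  · exact (mul_eq_zero.mp (show (M 0 0 + M 1 1) * M 1 0 = 0 by
      linear_combination h3)).resolve_left h0
  · exact sub_eq_zero.mp ((mul_eq_zero.mp (show (M 0 0 + M 1 1) * (M 0 0 - M 1 1) = 0 by
      linear_combination h4)).resolve_left h0)

/-- The list `l` is stable under the half-turn about `w`. -/
def HalfTurnStable {R : Type u} [CommRing R] (w : R × R × R) (l : List (R × R × R)) : Prop :=
  ∀ v ∈ l, halfTurn w v ∈ l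

instance decidableHalfTurnStable {R : Type u} [CommRing R] [DecidableEq R] (w : R × R × R)
    (l : List (R × R × R)) : Decidable (HalfTurnStable w l) :=
  List.decidableBAll (fun v => halfTurn w v ∈ l) l

/-- If every unit vector over `K ≃ F` preserves one of a list of small sets, then `PSL₂(F)` is not
generated by flag reflections. -/
theorem not_flagReflections {F : Type u} [Field F] [Finite F]
    [IsSimpleGroup (ProjectiveSpecialLinearGroup (Fin 2) F)] (h2 : (2 : F) ≠ 0) {K : Type v}
    [CommRing K] (e : K ≃+* F) (L : List (List (K × K × K)))
    (hL : ∀ l ∈ L, l.Nodup) (hcard : ∀ l ∈ L, ¬ Nat.card F ∣ l.length)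
    (h0 : ∀ l ∈ L, 0 ∉ l.map fun v => dot v v)
    (hA : ∀ l ∈ L, HalfTurnStable (1, 0, 0) l)
    (hC : ∀ l ∈ L, HalfTurnStable (0, 1, 0) l)
    (hB : ∀ a b c : K, dot (a, b, c) (a, b, c) = 1 → ∃ l ∈ L, HalfTurnStable (a, b, c) l) :
    ¬ GeneratedByFlagReflections (ProjectiveSpecialLinearGroup (Fin 2) F) := by
  classical
  rintro ⟨a, b, c, ha, hb, hc, hac, hcl⟩
  have nc := proj_not_comm (F := F)
  have ha1 : a ≠ 1 := by
    rintro rfl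
    rw [Subgroup.closure_insert_one] at hcl
    exact nc (forall_commute_of_closure_involutions hb hc hcl)
  have hc1 : c ≠ 1 := by
    rintro rfl
    rw [Set.pair_comm, Set.insert_comm, Subgroup.closure_insert_one] at hcl
    exact nc (forall_commute_of_closure_involutions ha hb hcl)
  have hb1 : b ≠ 1 := by
    rintro rfl
    rw [Set.insert_comm, Subgroup.closure_insert_one] at hcl
    exact nc (forall_commute_of_closure_involutions ha hc hcl)
  -- Non-triviality of `ac` makes its lift traceless as well, which is the orthogonality of the two
  -- axes.
  have hac1 : a * c ≠ 1 := by
    intro h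
    have : c = a := by
      rw [← inv_eq_of_mul_eq_one_left ha]; exact (inv_eq_of_mul_eq_one_right h).symm
    rw [this, Set.pair_comm, Set.insert_eq_of_mem (by simp)] at hcl
    exact nc (forall_commute_of_closure_involutions ha hb hcl)
  have hac2 : (a * c) * (a * c) = 1 := by
    rw [mul_assoc, ← mul_assoc c, ← hac, mul_assoc a c, hc, mul_one, ha]
  obtain ⟨A, rfl⟩ := proj_surjective a
  obtain ⟨B, rfl⟩ := proj_surjective b
  obtain ⟨C, rfl⟩ := proj_surjective c
  rw [← map_mul] at hac1 hac2
  obtain ⟨w, hw, hS⟩ := exists_unit_card_dvd h2 (trace_eq_zero_of_proj ha ha1)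
    (trace_eq_zero_of_proj hb hb1) (trace_eq_zero_of_proj hc hc1)
    (trace_eq_zero_of_proj hac2 hac1) (by
      rw [Set.image_insert_eq, Set.image_insert_eq, Set.image_singleton]; exact hcl)
  let E : K × K × K → F × F × F := fun v => (e v.1, e v.2.1, e v.2.2)
  have hE : Function.Injective E := by
    intro x y h
    simp only [E, Prod.mk.injEq, e.injective.eq_iff] at h
    exact Prod.ext h.1 (Prod.ext h.2.1 h.2.2)
  have hdot : ∀ x y, dot (E x) (E y) = e (dot x y) := fun x y => by simp [dot, E]
  have hturn : ∀ x y, halfTurn (E x) (E y) = E (halfTurn x y) := by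
    intro x y
    rw [halfTurn, hdot]
    simp [halfTurn, E, map_ofNat]
  obtain ⟨w', rfl⟩ : ∃ w', w = E w' :=
    ⟨(e.symm w.1, e.symm w.2.1, e.symm w.2.2), by simp [E]⟩
  obtain ⟨l, hl, hlw⟩ := hB w'.1 w'.2.1 w'.2.2 (e.injective (by
    rw [map_one, ← hw, hdot]))
  have he1 : E (1, 0, 0) = (1, 0, 0) := by simp [E]
  have he2 : E (0, 1, 0) = (0, 1, 0) := by simp [E]
  have hstab : ∀ y, HalfTurnStable y l →
      ∀ v ∈ (l.map E).toFinset, halfTurn (E y) v ∈ (l.map E).toFinset := by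
    intro y hy v hv
    rw [List.mem_toFinset, List.mem_map] at *
    obtain ⟨x, hx, rfl⟩ := hv
    exact ⟨_, hy x hx, (hturn y x).symm⟩
  have hd := hS (l.map E).toFinset (by
      intro v hv
      rw [List.mem_toFinset, List.mem_map] at hv
      obtain ⟨x, hx, rfl⟩ := hv
      rw [hdot]
      exact fun h => h0 l hl (List.mem_map.mpr ⟨x, hx, e.injective (h.trans (map_zero e).symm)⟩))
    (he1 ▸ hstab _ (hA l hl)) (he2 ▸ hstab _ (hC l hl)) (hstab _ hlw)
  rw [List.toFinset_card_of_nodup ((hL l hl).map hE), List.length_map] at hd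
  exact hcard l hl hd

/-- Candidates for sets of vectors preserved by the half-turns about three axes, the first two
being orthogonal; here `h² = 1 / 2`. -/
def frames {R : Type u} [CommRing R] (h : R) : List (List (R × R × R)) :=
  [[(1, 0, 0), (-1, 0, 0)], [(0, 1, 0), (0, -1, 0)],
    [(1, 0, 0), (-1, 0, 0), (0, 1, 0), (0, -1, 0), (0, 0, 1), (0, 0, -1)],
    [(1, 0, 0), (-1, 0, 0), (0, h, h), (0, h, -h), (0, -h, h), (0, -h, -h)],
    [(0, 1, 0), (0, -1, 0), (h, 0, h), (h, 0, -h), (-h, 0, h), (-h, 0, -h)],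
    [(0, 0, 1), (0, 0, -1), (h, h, 0), (h, -h, 0), (-h, h, 0), (-h, -h, 0)]]

/-- The vertices of an icosahedron, for a root `r` of `r² = r + 1`. -/
def icosahedron {R : Type u} [CommRing R] (r : R) : List (R × R × R) :=
  [(0, 1, r), (0, 1, -r), (0, -1, r), (0, -1, -r), (r, 0, 1), (-r, 0, 1), (r, 0, -1), (-r, 0, -1),
    (1, r, 0), (1, -r, 0), (-1, r, 0), (-1, -r, 0)]

/-- Here `2² = 4 = 1/2`. Each unit axis stabilises a pair of opposite vectors or an octahedron, of
size 2 or 6, and neither is divisible by 7. -/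
theorem not_flagReflections_of_card_seven {F : Type u} [Field F] [Finite F]
    [IsSimpleGroup (ProjectiveSpecialLinearGroup (Fin 2) F)] (hF : Nat.card F = 7) :
    ¬ GeneratedByFlagReflections (ProjectiveSpecialLinearGroup (Fin 2) F) := by
  have := Fintype.ofFinite F
  have h7 : (7 : F) = 0 := by exact_mod_cast card_cast_eq_zero F hF
  have e : ZMod 7 ≃+* F := ZMod.ringEquivOfPrime F (by norm_num)
    (by rw [← Nat.card_eq_fintype_card, hF])
  refine not_flagReflections (fun h => one_ne_zero (show (1 : F) = 0 by
    linear_combination h7 - 3 * h)) e (frames 2) ?_ ?_ ?_ ?_ ?_ ?_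
  · decide +kernel
  · rw [hF]; decide +kernel
  · decide +kernel
  · decide +kernel
  · decide +kernel
  · decide +kernel

/-- The field of nine elements. -/
abbrev F9 : Type := QuadraticAlgebra (ZMod 3) (-1) 0

instance instFintypeF9 : Fintype F9 :=
  Fintype.ofEquiv _ (QuadraticAlgebra.equivProd (-1 : ZMod 3) 0).symm

/-- The sets of vectors over the field of nine elements preserved by three half-turns. -/
def framesNine : List (List (F9 × F9 × F9)) :=
  frames ⟨0, 1⟩ ++ [icosahedron ⟨-1, 1⟩, icosahedron ⟨-1, -1⟩]

theorem framesNine_nodup : ∀ l ∈ framesNine, l.Nodup := by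
  decide +kernel

theorem framesNine_length : ∀ l ∈ framesNine, ¬ 9 ∣ l.length := by
  decide +kernel

theorem framesNine_dot : ∀ l ∈ framesNine, 0 ∉ l.map fun v => dot v v := by
  decide +kernel

theorem framesNine_fst : ∀ l ∈ framesNine, HalfTurnStable (1, 0, 0) l := by
  decide +kernel

theorem framesNine_snd : ∀ l ∈ framesNine, HalfTurnStable (0, 1, 0) l := by
  decide +kernel

/-- An exhaustive check over all unit axes. The icosahedra are available because `-1 ± i` are the
roots of `r² = r + 1` in characteristic 3. -/
theorem framesNine_unit : ∀ a b c : F9, dot (a, b, c) (a, b, c) = 1 →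
    ∃ l ∈ framesNine, HalfTurnStable (a, b, c) l := by
  decide +kernel

theorem not_flagReflections_of_card_nine {F : Type u} [Field F] [Finite F]
    [IsSimpleGroup (ProjectiveSpecialLinearGroup (Fin 2) F)] (hF : Nat.card F = 9) :
    ¬ GeneratedByFlagReflections (ProjectiveSpecialLinearGroup (Fin 2) F) := by
  have := Fintype.ofFinite F
  have h9 : (9 : F) = 0 := by exact_mod_cast card_cast_eq_zero F hF
  -- `-1` is not a square modulo 3; this fact supplies the field structure on `F9`.
  have : Fact (∀ r : ZMod 3, r ^ 2 ≠ -1 + 0 * r) := ⟨by decide⟩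
  have e : F9 ≃+* F := FiniteField.ringEquivOfCardEq (K := F9) (K' := F)
    (by rw [← Nat.card_eq_fintype_card (α := F), hF]; rfl)
  refine not_flagReflections (fun h => one_ne_zero (show (1 : F) = 0 by
    linear_combination h9 - 4 * h)) e framesNine framesNine_nodup ?_ framesNine_dot framesNine_fst
    framesNine_snd framesNine_unit
  rw [hF]
  exact framesNine_length

/-- `PSL₂(2) ≅ S₃` is not simple, but it has such generators, so this order need not be excluded. -/
theorem flagReflections_of_card_two {F : Type u} [Field F] [Finite F] (hF : Nat.card F = 2) :
    GeneratedByFlagReflections (ProjectiveSpecialLinearGroup (Fin 2) F) := by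
  have h2 : (2 : F) = 0 := by exact_mod_cast card_cast_eq_zero F hF
  refine flagReflections_of_entries (a := 1) (b := 1) (c := 0) (a' := 0) (b' := 1) (c' := 1)
    (a'' := 1) (b'' := 1) (c'' := 0) (by linear_combination -h2) (by linear_combination -h2)
    (by linear_combination -h2) (by linear_combination h2) ?_
  intro H hA hB _
  exact eq_top_of_prime_card (by rw [hF]; norm_num) (t := 1)
    (hA.congr rfl rfl rfl (by linear_combination -h2)) one_ne_zero hB one_ne_zero

theorem zmod_three_mul : ∀ a b c a' b' c' : ZMod 3, a * -a - b * c = 1 → a' * -a' - b' * c' = 1 →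
    2 * (a * a') + b * c' + c * b' = 0 ∨
      a * b' + b * -a' = 0 ∧ c * a' + -a * c' = 0 ∧ a * a' + b * c' = c * b' + -a * -a' := by
  decide +kernel

/-- `PSL₂(3) ≅ A₄` has a normal Klein four-group. Its preimage consists of the centre and the
traceless matrices, closed under products by `zmod_three_mul`; it contains the Weyl element but not
the unipotent with parameter 1. -/
theorem card_ne_three {F : Type u} [Field F] [Finite F]
    [IsSimpleGroup (ProjectiveSpecialLinearGroup (Fin 2) F)] : Nat.card F ≠ 3 := by
  intro hF
  have := Fintype.ofFinite F
  have h3 : (3 : F) = 0 := by exact_mod_cast card_cast_eq_zero F hF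
  have h2 : (2 : F) ≠ 0 := fun h => one_ne_zero (show (1 : F) = 0 by linear_combination h3 - h)
  have e : F ≃+* ZMod 3 := (ZMod.ringEquivOfPrime F (by norm_num)
    (by rw [← Nat.card_eq_fintype_card, hF])).symm
  have key : ∀ M N : SpecialLinearGroup (Fin 2) F, M 0 0 + M 1 1 = 0 → N 0 0 + N 1 1 = 0 →
      (M * N) 0 0 + (M * N) 1 1 = 0 ∨ proj F (M * N) = 1 := by
    intro M N hM hN
    have dM := det_entry M
    have dN := det_entry N
    have eM : M 1 1 = -M 0 0 := by linear_combination hM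
    have eN : N 1 1 = -N 0 0 := by linear_combination hN
    rw [proj_eq_one_iff]
    simp only [mul_entry]
    rw [eM] at dM ⊢
    rw [eN] at dN ⊢
    have k := zmod_three_mul (e (M 0 0)) (e (M 0 1)) (e (M 1 0)) (e (N 0 0)) (e (N 0 1)) (e (N 1 0))
      (by simpa only [map_sub, map_mul, map_neg, map_one] using congrArg e dM)
      (by simpa only [map_sub, map_mul, map_neg, map_one] using congrArg e dN)
    have h2e : (2 : ZMod 3) = e 2 := (map_ofNat e 2).symm
    rw [h2e] at k
    simp only [← map_mul, ← map_add, ← map_neg, e.map_eq_zero_iff, e.injective.eq_iff] at k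
    refine k.imp (fun h => by linear_combination h) (fun h => h)
  let K : Subgroup (SpecialLinearGroup (Fin 2) F) :=
    { carrier := {M | M 0 0 + M 1 1 = 0 ∨ proj F M = 1}
      one_mem' := Or.inr (map_one _)
      mul_mem' := by
        have scal : ∀ M N : SpecialLinearGroup (Fin 2) F, proj F M = 1 → N 0 0 + N 1 1 = 0 →
            (M * N) 0 0 + (M * N) 1 1 = 0 ∧ (N * M) 0 0 + (N * M) 1 1 = 0 := by
          intro M N hM hN
          obtain ⟨k1, k2, k3⟩ := proj_eq_one_iff.mp hM
          simp only [mul_entry, k1, k2, ← k3]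
          constructor <;> linear_combination M 0 0 * hN
        rintro M N (hM | hM) (hN | hN)
        · exact key M N hM hN
        · exact Or.inl (scal N M hN hM).2
        · exact Or.inl (scal M N hM hN).1
        · right; rw [map_mul, hM, hN, one_mul]
      inv_mem' := by
        rintro M (hM | hM)
        · left
          rw [Matrix.SpecialLinearGroup.SL2_inv_expl]
          change M 1 1 + M 0 0 = 0
          rw [add_comm, hM]
        · right; rw [map_inv, hM, inv_one] }
  have hconj : ∀ M ∈ K, ∀ X, X * M * X⁻¹ ∈ K := by
    rintro M (hM | hM) X
    · left
      have hX := det_entry X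
      have i00 : X⁻¹ 0 0 = X 1 1 := by rw [SpecialLinearGroup.SL2_inv_expl]; rfl
      have i01 : X⁻¹ 0 1 = -X 0 1 := by rw [SpecialLinearGroup.SL2_inv_expl]; rfl
      have i10 : X⁻¹ 1 0 = -X 1 0 := by rw [SpecialLinearGroup.SL2_inv_expl]; rfl
      have i11 : X⁻¹ 1 1 = X 0 0 := by rw [SpecialLinearGroup.SL2_inv_expl]; rfl
      change (X * M * X⁻¹) 0 0 + (X * M * X⁻¹) 1 1 = 0
      simp only [mul_entry, i00, i01, i10, i11]
      linear_combination (M 0 0 + M 1 1) * hX + hM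
    · right
      rw [map_mul, map_mul, hM, mul_one, ← map_mul, mul_inv_cancel, map_one]
  have hn : (K.map (proj F)).Normal := ⟨by
    rintro _ ⟨M, hM, rfl⟩ x
    obtain ⟨X, rfl⟩ := proj_surjective x
    exact ⟨_, hconj M hM X, by simp⟩⟩
  rcases hn.eq_bot_or_eq_top with hb | ht
  · have hJ : proj F (mk 0 1 (-1) 0 (by ring)) ∈ K.map (proj F) :=
      ⟨_, Or.inl (by simp), rfl⟩
    rw [hb, Subgroup.mem_bot, proj_eq_one_iff] at hJ
    exact one_ne_zero hJ.1
  · have hT : proj F (mk 1 1 0 1 (by ring)) ∈ K.map (proj F) := ht ▸ Subgroup.mem_top _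
    obtain ⟨M, hM, hMT⟩ := hT
    have hd : M⁻¹ * mk 1 1 0 1 (by ring) ∈ K := Or.inr (by
      rw [map_mul, map_inv, hMT, inv_mul_cancel])
    have hT : mk (1 : F) 1 0 1 (by ring) ∈ K := by
      have := mul_mem hM hd
      rwa [mul_inv_cancel_left] at this
    rcases hT with h | h
    · have h' : (1 : F) + 1 = 0 := h
      exact h2 (by linear_combination h')
    · rw [proj_eq_one_iff] at h
      exact one_ne_zero h.1

/-! ### Assembling the cases by the order of the field -/

instance finite_proj (F : Type u) [Field F] [Finite F] :
    Finite (Matrix.ProjectiveSpecialLinearGroup (Fin 2) F) :=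
  inferInstanceAs (Finite (_ ⧸ _))

theorem card_cases (F : Type u) [Field F] [Finite F]
    [IsSimpleGroup (Matrix.ProjectiveSpecialLinearGroup (Fin 2) F)] :
    Nat.card F = 2 ∨ Nat.card F = 4 ∨ Nat.card F = 5 ∨ Nat.card F = 7 ∨ Nat.card F = 9 ∨
      Nat.card F = 11 ∨ Nat.card F = 13 ∨ (16 ≤ Nat.card F ∨ Nat.card F = 8) := by
  have := Fintype.ofFinite F
  have hq : IsPrimePow (Nat.card F) := by
    rw [Nat.card_eq_fintype_card]; exact FiniteField.isPrimePow_card F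
  have h3 := card_ne_three (F := F)
  generalize Nat.card F = q at *
  have h1 := hq.one_lt
  by_contra! h
  obtain ⟨h2, h4, h5, h7, h9, h11, h13, h16, h8⟩ := h
  have key : ∀ {a b : ℕ}, a.Coprime b → 1 < a → 1 < b → q ≠ a * b := by
    rintro a b hab ha hb rfl
    rcases (Nat.Coprime.isPrimePow_dvd_mul hab hq).mp dvd_rfl with h | h
    · exact absurd (Nat.le_of_dvd (by omega) h) (by nlinarith)
    · exact absurd (Nat.le_of_dvd (by omega) h) (by nlinarith)
  have h6 := key (a := 2) (b := 3) (by norm_num) (by norm_num) (by norm_num)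
  have h10 := key (a := 2) (b := 5) (by norm_num) (by norm_num) (by norm_num)
  have h12 := key (a := 4) (b := 3) (by norm_num) (by norm_num) (by norm_num)
  have h14 := key (a := 2) (b := 7) (by norm_num) (by norm_num) (by norm_num)
  have h15 := key (a := 3) (b := 5) (by norm_num) (by norm_num) (by norm_num)
  omega

theorem generatedByFlagReflections_iff (F : Type u) [Field F] [Finite F]
    [IsSimpleGroup (Matrix.ProjectiveSpecialLinearGroup (Fin 2) F)] :
    GeneratedByFlagReflections (Matrix.ProjectiveSpecialLinearGroup (Fin 2) F) ↔
      Nat.card F ≠ 7 ∧ Nat.card F ≠ 9 := by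
  refine ⟨fun h => ⟨fun h7 => not_flagReflections_of_card_seven h7 h,
    fun h9 => not_flagReflections_of_card_nine h9 h⟩, fun ⟨h7, h9⟩ => ?_⟩
  rcases card_cases F with h | h | h | h | h | h | h | h
  · exact flagReflections_of_card_two h
  · exact flagReflections_of_card_four h
  · have h5 : (5 : F) = 0 := by exact_mod_cast card_cast_eq_zero F h
    exact flagReflections_of_prime (i := 2) (by rw [h]; norm_num) (by linear_combination h5)
  · exact absurd h h7
  · exact absurd h h9
  · exact flagReflections_of_card_eleven h
  · have h13 : (13 : F) = 0 := by exact_mod_cast card_cast_eq_zero F h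
    exact flagReflections_of_prime (i := 5) (by rw [h]; norm_num) (by linear_combination 2 * h13)
  · exact flagReflections_of_torus F h

/-- For 7 and 9 no flag reflections exist, so there the asymmetry comes from exponent 3 instead of
2. -/
theorem generatedByAsymmetricInvolutions (F : Type u) [Field F] [Finite F]
    [IsSimpleGroup (Matrix.ProjectiveSpecialLinearGroup (Fin 2) F)] :
    GeneratedByAsymmetricInvolutions (Matrix.ProjectiveSpecialLinearGroup (Fin 2) F) := by
  by_cases h7 : Nat.card F = 7
  · exact asymmetric_of_card_seven h7
  by_cases h9 : Nat.card F = 9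
  · exact asymmetric_of_card_nine h9
  exact ((generatedByFlagReflections_iff F).mpr ⟨h7, h9⟩).asymmetric proj_not_comm

end SL2

theorem theorem6p1 (F : Type u) [Field F] [Finite F]
    [IsSimpleGroup (Matrix.ProjectiveSpecialLinearGroup (Fin 2) F)] :
    (∀ T : EdgeTransitiveClass,
      T.Realises (Matrix.ProjectiveSpecialLinearGroup (Fin 2) F) ↔
        ((T = .one ∧ Nat.card F ≠ 7 ∧ Nat.card F ≠ 9) ∨
          (∃ σ, T = .two σ) ∨ T = .three ∨ (∃ σ, T = .four σ))) ∧
    ∀ σ : ClassSuperscript,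
      ¬ (EdgeTransitiveClass.twoEx σ).Realises (Matrix.ProjectiveSpecialLinearGroup (Fin 2) F) ∧
      ¬ (EdgeTransitiveClass.five σ).Realises (Matrix.ProjectiveSpecialLinearGroup (Fin 2) F) := by
  have hp := SL2.generatingPairsInvertible F
  have ha := SL2.generatedByAsymmetricInvolutions F
  have hex : ∀ σ, ¬ (EdgeTransitiveClass.twoEx σ).Realises
      (Matrix.ProjectiveSpecialLinearGroup (Fin 2) F) := fun σ h =>
    EdgeTransitiveClass.not_realisedOver_basicTwoEx hp
      ((FlagMap.RealisedOver.op_iff σ).mp ((EdgeTransitiveClass.realises_iff _ _).mp h))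
  have hfive : ∀ σ, ¬ (EdgeTransitiveClass.five σ).Realises
      (Matrix.ProjectiveSpecialLinearGroup (Fin 2) F) := fun σ h =>
    EdgeTransitiveClass.not_realisedOver_basicFive hp
      ((FlagMap.RealisedOver.op_iff σ).mp ((EdgeTransitiveClass.realises_iff _ _).mp h))
  refine ⟨fun T => ?_, fun σ => ⟨hex σ, hfive σ⟩⟩
  cases T with
  | one =>
    have : (EdgeTransitiveClass.one).Realises (Matrix.ProjectiveSpecialLinearGroup (Fin 2) F) ↔
        Nat.card F ≠ 7 ∧ Nat.card F ≠ 9 := by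
      rw [EdgeTransitiveClass.realises_iff, ← SL2.generatedByFlagReflections_iff]
      exact ⟨EdgeTransitiveClass.generatedByFlagReflections_of_realisedOver,
        EdgeTransitiveClass.realisedOver_basicMap_one⟩
    simpa using this
  | two σ =>
    refine iff_of_true ((EdgeTransitiveClass.realises_iff _ _).mpr
      ((FlagMap.RealisedOver.op_iff σ).mpr (EdgeTransitiveClass.realisedOver_basicTwo ha))) ?_
    simp
  | twoEx σ => exact iff_of_false (hex σ) (by simp)
  | three =>
    refine iff_of_true ((EdgeTransitiveClass.realises_iff _ _).mpr
      (EdgeTransitiveClass.realisedOver_basicThree ha)) ?_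
    simp
  | four σ =>
    refine iff_of_true ((EdgeTransitiveClass.realises_iff _ _).mpr
      ((FlagMap.RealisedOver.op_iff σ).mpr (EdgeTransitiveClass.realisedOver_basicFour ha))) ?_
    simp
  | five σ => exact iff_of_false (hfive σ) (by simp)
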